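/- **Setting.** Let $\Lambda=\mathbb Z^d\cap[-L,L]^d$ with the nearest-neighbour graph structure and $\mathcal H_\Lambda=\bigotimes_{x\in\Lambda}\mathbb C^q$. An extensive local operator is a sum $A=\sum_S A_S$ over nonempty connected $S\subseteq\Lambda$, where $A_S$ acts as the identity outside $S$; it is self-adjoint if every $A_S$ is. Its local norm is $$\|A\|_\kappa=\sup_{x\in\Lambda}\sum_{S\ni x}\|A_S\|_{\rm op}\,e^{\kappa|S|},$$ and it belongs to $\mathcal O_\kappa$ if this is finite. Write $\langle x\rangle=\sqrt{1+x^2}$. **Theorem.** Let $d\ge 0$ and $\kappa>0$. There are constants $C_{LR}(s)=C_{LR}(s,d,\kappa)>0$, $s\in\mathbb N$, such that the following holds for all $L,q$. Let $H=N+\varepsilon P$, where $P$ is a self-adjoint extensive local operator and $N=\sum_{x\in\Lambda}N_x$ is a sum of self-adjoint on-site operators with $\sigma(N)\subset\mathbb Z$ (for instance, $\sigma(N_x)\subset\mathbb Z$ for all $x$). Let $0<\varepsilon<\varepsilon_0$ with $$\varepsilon_0\le\frac{e-1}{64\pi\,(3(e-1)+e^2)\,\|P\|_\kappa}$$ (no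 condition if $P=0$). Then there are self-adjoint extensive local operators $\mathcal N,\mathcal Z\in\mathcal O_{\kappa/2}$ such that: 1. (i) $\sigma(\mathcal N)\subset\mathbb Z$; 2. (ii) $|\Lambda|^{-1}\|\mathcal N-N\|_{\rm op}\le \mathsf C_1\,\varepsilon\,\|N\|_\kappa$; 3. (iii) for all $t\in\mathbb R$, $|\Lambda|^{-1}\|e^{iHt}\mathcal Ne^{-iHt}-\mathcal N\|_{\rm op}\le\mathsf C_2\|N\|_{3\kappa/4}\,|t|\,\varepsilon\, e^{-\varepsilon_0/\varepsilon}$ and $|\Lambda|^{-1}\|e^{iHt}\mathcal Ze^{-iHt}-\mathcal Z\|_{\rm op}\le\mathsf C_3\,|t|\,\varepsilon^2 e^{-\varepsilon_0/\varepsilon}$; 4. (iv) $[\mathcal N,\mathcal Z]=0$; 5. (v) for every operator $O$ acting as the identity outside a connected set $S$, and all $|t|\le e^{\varepsilon_0/((d+1)\varepsilon)}$, $$\|e^{iHt}Oe^{-iHt}-e^{i(\mathcal N+\mathcal Z)t}Oe^{-i(\mathcal N+\mathcal Z)t}\|_{\rm op}\le\mathsf C_4\,\varepsilon\,\|O\|_{\rm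 op};$$ where $$\mathsf C_1=256\pi\frac{e}{e-1}\frac{e^{-\kappa/4}}{\kappa}\|P\|_\kappa,\qquad \mathsf C_2=\frac{16}{3\kappa}\|P\|_\kappa,\qquad \mathsf C_3=\frac{16}{3\kappa}\frac e{e-1}\|P\|_\kappa^2,$$ $$\mathsf C_4=8\pi\frac e{e-1}\|P\|_\kappa|S|+2^{d+1}C_{LR}(|S|)\Big\langle\|N\|_\kappa+\varepsilon\frac e{e-1}\|P\|_\kappa\Big\rangle^d e\,\|P\|_\kappa .$$ None of these constants depends on $|\Lambda|$. If moreover $\varepsilon_0\le\kappa\,\frac{e-1}{64\pi(3(e-1)+e^2)\|P\|_\kappa}$ (automatic for $\kappa\ge1$), then the same $\mathcal N,\mathcal Z$ are local uniformly in $|\Lambda|$ and $\varepsilon$: $$\|\mathcal N\|_{\kappa/2}\le4\|N\|_\kappa,\qquad \|\mathcal Z\|_{\kappa/2}\le\frac{4e}{e-1}\,\varepsilon\,\|P\|_\kappa .$$ -/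

import Mathlib

open scoped Matrix.Norms.L2Operator

noncomputable section

namespace Lattice

/-- The box `ℤ^d ∩ [-L, L]^d`. -/
abbrev Site (d L : ℕ) : Type := Fin d → Set.Icc (-(L : ℤ)) (L : ℤ)

/-- Nearest-neighbour graph of the box: two sites are adjacent when their `ℓ¹` distance is one. -/
def graph (d L : ℕ) : SimpleGraph (Site d L) where
  Adj x y := ∑ i, |(x i : ℤ) - (y i : ℤ)| = 1
  symm := ⟨fun x y h => by simpa only [abs_sub_comm] using h⟩
  loopless := ⟨fun x h => by simp at h⟩

/-- `S` is a (nonempty) connected subset of the box. -/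
def IsConn {d L : ℕ} (S : Finset (Site d L)) : Prop :=
  ((graph d L).induce (S : Set (Site d L))).Connected

/-- Operators on `⨂_{x ∈ Λ} ℂ^q`, as matrices in the product basis, which is indexed by the
configurations `Λ → Fin q`. The norm is the operator norm for the Hilbert space norm, and the star
is the adjoint. -/
abbrev Op (d L q : ℕ) : Type := Matrix (Site d L → Fin q) (Site d L → Fin q) ℂ

/-- `A = a ⊗ 1` with `a` acting on the sites of `S` and the identity acting on the others. -/
def SupportedOn {d L q : ℕ} (S : Finset (Site d L)) (A : Op d L q) : Prop :=
  ∃ a : Matrix (S → Fin q) (S → Fin q) ℂ, ∀ σ τ : Site d L → Fin q,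
    ((∀ x, x ∉ S → σ x = τ x) → A σ τ = a (fun x => σ x) (fun x => τ x)) ∧
    ((∃ x, x ∉ S ∧ σ x ≠ τ x) → A σ τ = 0)

/-- An extensive local operator, given by its local terms `A_S`, `S` connected. (The terms are
indexed by all finite sets, those of sets that are not connected being zero.) -/
structure ExtOp (d L q : ℕ) where
  term : Finset (Site d L) → Op d L q
  supported : ∀ S, SupportedOn S (term S)
  term_eq_zero : ∀ S, ¬ IsConn S → term S = 0

namespace ExtOp

variable {d L q : ℕ}

/-- The operator `∑_S A_S`. -/
def op (A : ExtOp d L q) : Op d L q := ∑ S, A.term S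

/-- Every local term is self-adjoint. -/
def SelfAdj (A : ExtOp d L q) : Prop := ∀ S, IsSelfAdjoint (A.term S)

/-- A sum of on-site terms: only the sets with one element contribute. -/
def OnSite (A : ExtOp d L q) : Prop := ∀ S, S.card ≠ 1 → A.term S = 0

/-- `‖A‖_κ = sup_x ∑_{S ∋ x} ‖A_S‖ e^{κ |S|}` -/
def norm (κ : ℝ) (A : ExtOp d L q) : ℝ :=
  ⨆ x : Site d L, ∑ S : Finset (Site d L) with x ∈ S, ‖A.term S‖ * Real.exp (κ * S.card)

end ExtOp

/-- The spectrum of `A` consists of integers. -/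
def IntSpectrum {d L q : ℕ} (A : Op d L q) : Prop :=
  ∀ z ∈ spectrum ℂ A, ∃ n : ℤ, z = n

/-- Heisenberg evolution `e^{i H t} A e^{-i H t}`. -/
def evol {d L q : ℕ} (H : Op d L q) (t : ℝ) (A : Op d L q) : Op d L q :=
  NormedSpace.exp ((Complex.I * t) • H) * A * NormedSpace.exp (-(Complex.I * t) • H)

/-- `⟨x⟩ = (1 + x²)^{1/2}` -/
def bracket (x : ℝ) : ℝ := Real.sqrt (1 + x ^ 2)

end Lattice

end

/-!
Since `N` has integer spectrum, conjugation by `e^{isN}` is `2π`-periodic. Averaging a perturbation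
`V` over one period gives its part commuting with `N`, and the sawtooth-weighted average `A` solves
`i[A, N] = ⟨V⟩ - V`; as the terms of `N` sit on single sites, both averages act on each local term
separately and do not enlarge its support. Conjugating by the exponential of `A` therefore replaces
`V` by its mean plus an error of second order, at the price of a fixed amount of the decay rate `κ`.
Iterating this about `ε₀ / ε` times turns `N + εP` into `N + Z + V` with `[N, Z] = 0` and `V`
exponentially small; the operators of the theorem are `N` and `Z` rotated back. The evolution of
local observables is compared by Duhamel's formula and a Lieb–Robinson bound, whose light cone has
volume `t^d`; this is why the times of the last assertion are of order `e^{ε₀ / ((d + 1) ε)}`.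
When `κ` is too small for the iteration to fit, locality is not asserted, and it is enough to round
the spectrum of `N + εP` to integers, which gives an exactly conserved quantity.
-/

open scoped Matrix.Norms.L2Operator

noncomputable section

open Lattice

attribute [local instance] LieRing.ofAssociativeRing

namespace Prethermal

theorem norm_lie_le {𝔸 : Type*} [NormedRing 𝔸] (A B : 𝔸) : ‖⁅A, B⁆‖ ≤ 2 * ‖A‖ * ‖B‖ :=
  calc ‖A * B - B * A‖ ≤ ‖A‖ * ‖B‖ + ‖B‖ * ‖A‖ :=
        (norm_sub_le _ _).trans (add_le_add (norm_mul_le _ _) (norm_mul_le _ _))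
    _ = 2 * ‖A‖ * ‖B‖ := by ring

section BanachAlgebra

open Complex

variable {𝔸 : Type*} [NormedRing 𝔸] [NormedAlgebra ℂ 𝔸] [CompleteSpace 𝔸]

/-- The propagator `e^{iHt}`, as a unit of the algebra. -/
def propagator (H : 𝔸) (t : ℝ) : 𝔸ˣ :=
  let _ : NormedAlgebra ℚ 𝔸 := NormedAlgebra.restrictScalars ℚ ℂ 𝔸
  { val := NormedSpace.exp ((I * t) • H)
    inv := NormedSpace.exp (-(I * t) • H)
    val_inv := by
      rw [neg_smul, ← NormedSpace.exp_add_of_commute (Commute.refl _).neg_right, add_neg_cancel,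
        NormedSpace.exp_zero]
    inv_val := by
      rw [neg_smul, ← NormedSpace.exp_add_of_commute (Commute.refl _).neg_left, neg_add_cancel,
        NormedSpace.exp_zero] }

theorem coe_propagator (H : 𝔸) (t : ℝ) :
    (propagator H t : 𝔸) = NormedSpace.exp ((I * t) • H) := rfl

theorem coe_propagator_inv (H : 𝔸) (t : ℝ) :
    (↑(propagator H t)⁻¹ : 𝔸) = NormedSpace.exp (-(I * t) • H) := rfl

theorem propagator_neg_time (H : 𝔸) (t : ℝ) : propagator H (-t) = (propagator H t)⁻¹ := by
  ext
  simp [coe_propagator, coe_propagator_inv]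

theorem propagator_zero_time (H : 𝔸) : propagator H 0 = 1 := by
  ext
  simp [coe_propagator]

theorem commute_propagator {H A : 𝔸} (h : Commute H A) (t : ℝ) :
    Commute (propagator H t : 𝔸) A := by
  let _ : NormedAlgebra ℚ 𝔸 := NormedAlgebra.restrictScalars ℚ ℂ 𝔸
  exact (h.smul_left _).exp_left

theorem propagator_add {H K : 𝔸} (h : Commute H K) (t : ℝ) :
    propagator (H + K) t = propagator H t * propagator K t := by
  let _ : NormedAlgebra ℚ 𝔸 := NormedAlgebra.restrictScalars ℚ ℂ 𝔸
  ext
  rw [Units.val_mul, coe_propagator, smul_add,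
    NormedSpace.exp_add_of_commute ((h.smul_left _).smul_right _), coe_propagator, coe_propagator]

/-- Heisenberg evolution `A ↦ e^{iHt} A e^{-iHt}`, as an automorphism of the algebra. -/
def heisenberg (H : 𝔸) (t : ℝ) : 𝔸 ≃ₐ[ℂ] 𝔸 :=
  MulSemiringAction.toAlgEquiv ℂ 𝔸 (ConjAct.toConjAct (propagator H t))

theorem heisenberg_apply (H : 𝔸) (t : ℝ) (A : 𝔸) :
    heisenberg H t A = propagator H t * A * ↑(propagator H t)⁻¹ := rfl

theorem heisenberg_neg_time (H : 𝔸) (t : ℝ) : heisenberg H (-t) = (heisenberg H t).symm := by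
  ext A
  rw [AlgEquiv.eq_symm_apply, heisenberg_apply, heisenberg_apply, propagator_neg_time, inv_inv]
  simp only [mul_assoc, Units.mul_inv_cancel_left, Units.mul_inv, mul_one]

theorem heisenberg_neg (H : 𝔸) (t : ℝ) : heisenberg (-H) t = heisenberg H (-t) := by
  ext A
  simp [heisenberg_apply, coe_propagator, coe_propagator_inv]

@[simp]
theorem heisenberg_zero_time (H A : 𝔸) : heisenberg H 0 A = A := by
  simp [heisenberg_apply, propagator_zero_time]

theorem heisenberg_of_commute {H A : 𝔸} (h : Commute H A) (t : ℝ) : heisenberg H t A = A := by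
  rw [heisenberg_apply, (commute_propagator h t).eq, mul_assoc, Units.mul_inv, mul_one]

theorem heisenberg_add_of_commute {H K A : 𝔸} (hHK : Commute H K) (hKA : Commute K A) (t : ℝ) :
    heisenberg (H + K) t A = heisenberg H t A := by
  rw [heisenberg_apply, propagator_add hHK, mul_inv_rev, Units.val_mul, Units.val_mul,
    mul_assoc (propagator H t : 𝔸), (commute_propagator hKA t).eq, heisenberg_apply]
  simp only [mul_assoc, Units.mul_inv_cancel_left]

theorem heisenberg_lie_self (H A : 𝔸) (t : ℝ) : heisenberg H t ⁅H, A⁆ = ⁅H, heisenberg H t A⁆ := by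
  rw [Ring.lie_def, map_sub, map_mul, map_mul, heisenberg_of_commute (Commute.refl H), Ring.lie_def]

theorem hasDerivAt_propagator (H : 𝔸) (s : ℝ) :
    HasDerivAt (fun s => (propagator H s : 𝔸)) (propagator H s * (I • H)) s := by
  have hI (c : ℝ) : (I * c) • H = c • (I • H) := by rw [← Complex.coe_smul, smul_smul, mul_comm]
  simpa only [coe_propagator, hI] using hasDerivAt_exp_smul_const (𝕂 := ℝ) (I • H) s

theorem hasDerivAt_propagator_inv (H : 𝔸) (s : ℝ) :
    HasDerivAt (fun s => (↑(propagator H s)⁻¹ : 𝔸)) (-((I • H) * ↑(propagator H s)⁻¹)) s := by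
  have hI (c : ℝ) : (I * c) • H = c • (I • H) := by rw [← Complex.coe_smul, smul_smul, mul_comm]
  simpa only [coe_propagator_inv, neg_smul, hI, smul_neg, neg_mul] using
    hasDerivAt_exp_smul_const' (𝕂 := ℝ) (-(I • H)) s

theorem hasDerivAt_heisenberg_apply (H : 𝔸) {g : ℝ → 𝔸} {g' : 𝔸} {s : ℝ}
    (hg : HasDerivAt g g' s) :
    HasDerivAt (fun s => heisenberg H s (g s)) (heisenberg H s (I • ⁅H, g s⁆ + g')) s := by
  refine (((hasDerivAt_propagator H s).mul hg).mul (hasDerivAt_propagator_inv H s)).congr_deriv ?_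
  simp only [heisenberg_apply, Ring.lie_def, Pi.mul_apply, smul_sub, mul_add, add_mul, mul_sub,
    sub_mul, mul_assoc, smul_mul_assoc, mul_smul_comm, mul_neg]
  abel

theorem hasDerivAt_heisenberg (H A : 𝔸) (s : ℝ) :
    HasDerivAt (fun s => heisenberg H s A) (heisenberg H s (I • ⁅H, A⁆)) s := by
  simpa using hasDerivAt_heisenberg_apply H (hasDerivAt_const s A)

theorem hasDerivAt_heisenberg' (H A : 𝔸) (s : ℝ) :
    HasDerivAt (fun s => heisenberg H s A) (I • ⁅H, heisenberg H s A⁆) s := by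
  rw [← heisenberg_lie_self, ← map_smul]
  exact hasDerivAt_heisenberg H A s

theorem continuous_heisenberg (H A : 𝔸) : Continuous fun s => heisenberg H s A :=
  continuous_iff_continuousAt.2 fun s => (hasDerivAt_heisenberg H A s).continuousAt

end BanachAlgebra

section CStarAlgebra

open Complex

variable {𝔸 : Type*} [CStarAlgebra 𝔸]

theorem isSelfAdjoint_I_smul_lie {A B : 𝔸} (hA : IsSelfAdjoint A) (hB : IsSelfAdjoint B) :
    IsSelfAdjoint (I • ⁅A, B⁆) := by
  rw [IsSelfAdjoint, star_smul, Ring.lie_def, star_sub, star_mul, star_mul, hA.star_eq, hB.star_eq,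
    ← neg_sub, smul_neg]
  simp

theorem star_propagator {H : 𝔸} (hH : IsSelfAdjoint H) (t : ℝ) :
    star (propagator H t : 𝔸) = ↑(propagator H t)⁻¹ := by
  let _ : NormedAlgebra ℚ 𝔸 := NormedAlgebra.restrictScalars ℚ ℂ 𝔸
  rw [coe_propagator, coe_propagator_inv, NormedSpace.star_exp, star_smul, hH.star_eq]
  simp

theorem propagator_mem_unitary {H : 𝔸} (hH : IsSelfAdjoint H) (t : ℝ) :
    (propagator H t : 𝔸) ∈ unitary 𝔸 := by
  rw [Unitary.mem_iff, star_propagator hH]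
  exact ⟨Units.inv_mul _, Units.mul_inv _⟩

theorem norm_propagator_sub_propagator_le {H N : 𝔸} (hH : IsSelfAdjoint H) (hN : IsSelfAdjoint N)
    (t : ℝ) : ‖(propagator H t - propagator N t : 𝔸)‖ ≤ |t| * ‖H - N‖ := by
  have hderiv (s : ℝ) : HasDerivAt (fun s => (propagator H s : 𝔸) * ↑(propagator N s)⁻¹)
      (propagator H s * (I • (H - N)) * ↑(propagator N s)⁻¹) s := by
    refine ((hasDerivAt_propagator H s).mul (hasDerivAt_propagator_inv N s)).congr_deriv ?_
    simp only [smul_sub, mul_sub, sub_mul, mul_assoc, mul_neg]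
    abel
  have hinv (s : ℝ) : (↑(propagator N s)⁻¹ : 𝔸) ∈ unitary 𝔸 := by
    rw [← propagator_neg_time]
    exact propagator_mem_unitary hN _
  have hmul := convex_univ.norm_image_sub_le_of_norm_hasDerivWithin_le (𝕜 := ℝ)
    (f := fun s => (propagator H s : 𝔸) * ↑(propagator N s)⁻¹) (x := 0) (y := t) (C := ‖H - N‖)
    (fun s _ => (hderiv s).hasDerivWithinAt)
    (fun s _ => by
      rw [CStarRing.norm_mul_mem_unitary _ (hinv s),
        CStarRing.norm_mem_unitary_mul _ (propagator_mem_unitary hH s), norm_smul, norm_I,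
        one_mul]) trivial trivial
  rw [propagator_zero_time, propagator_zero_time, inv_one, Units.val_one, mul_one,
    sub_zero, mul_comm] at hmul
  rwa [← CStarRing.norm_mul_mem_unitary _ (hinv t), sub_mul, Units.mul_inv]

theorem star_heisenberg {H : 𝔸} (hH : IsSelfAdjoint H) (t : ℝ) (A : 𝔸) :
    heisenberg H t (star A) = star (heisenberg H t A) := by
  rw [heisenberg_apply, heisenberg_apply, star_mul, star_mul, ← star_propagator hH, star_star,
    mul_assoc]

/-- Heisenberg evolution of a self-adjoint Hamiltonian respects the adjoint. This bundled form
gives access to the general facts on ⋆-automorphisms, such as their being isometric. -/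
def heisenbergStar {H : 𝔸} (hH : IsSelfAdjoint H) (t : ℝ) : 𝔸 ≃⋆ₐ[ℂ] 𝔸 :=
  StarAlgEquiv.ofAlgEquiv (heisenberg H t) (star_heisenberg hH t)

theorem norm_heisenberg {H : 𝔸} (hH : IsSelfAdjoint H) (t : ℝ) (A : 𝔸) :
    ‖heisenberg H t A‖ = ‖A‖ :=
  NonUnitalStarAlgHom.norm_map (heisenbergStar hH t) (heisenbergStar hH t).injective A

theorem norm_heisenberg_sub_le {H : 𝔸} (hH : IsSelfAdjoint H) (t : ℝ) (A : 𝔸) :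
    ‖heisenberg H t A - A‖ ≤ |t| * ‖⁅H, A⁆‖ := by
  have h := convex_univ.norm_image_sub_le_of_norm_hasDerivWithin_le (𝕜 := ℝ)
    (f := fun s => heisenberg H s A) (x := 0) (y := t) (C := ‖⁅H, A⁆‖)
    (fun s _ => (hasDerivAt_heisenberg H A s).hasDerivWithinAt)
    (fun s _ => by rw [norm_heisenberg hH, norm_smul, norm_I, one_mul]) trivial trivial
  simpa [mul_comm] using h

/-- The Duhamel argument: `s ↦ e^{-iKs} (e^{iHs} O e^{-iHs}) e^{iKs}` with `K = H - W` has a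
derivative of norm `‖[W, e^{iHs} O e^{-iHs}]‖`. -/
theorem norm_heisenberg_sub_heisenberg_le {H W : 𝔸} (hH : IsSelfAdjoint H) (hW : IsSelfAdjoint W)
    {t c : ℝ} (ht : 0 ≤ t) (O : 𝔸) (hc : ∀ s, 0 ≤ s → s ≤ t → ‖⁅W, heisenberg H s O⁆‖ ≤ c) :
    ‖heisenberg H t O - heisenberg (H - W) t O‖ ≤ c * t := by
  set K := H - W with hK
  have hKsa : IsSelfAdjoint K := hH.sub hW
  have hderiv (s : ℝ) : HasDerivAt (fun s => heisenberg (-K) s (heisenberg H s O))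
      (heisenberg (-K) s (I • ⁅W, heisenberg H s O⁆)) s := by
    refine (hasDerivAt_heisenberg_apply (-K) (hasDerivAt_heisenberg' H O s)).congr_deriv ?_
    rw [← smul_add, hK, neg_sub, sub_lie, sub_add_cancel]
  have hint := (convex_Icc 0 t).norm_image_sub_le_of_norm_hasDerivWithin_le (𝕜 := ℝ)
    (fun s _ => (hderiv s).hasDerivWithinAt)
    (fun s hs => by
      rw [norm_heisenberg hKsa.neg, norm_smul, norm_I, one_mul]; exact hc s hs.1 hs.2)
    ⟨le_rfl, ht⟩ ⟨ht, le_rfl⟩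
  have hback : heisenberg H t O - heisenberg K t O =
      heisenberg K t (heisenberg (-K) t (heisenberg H t O) - O) := by
    rw [map_sub, heisenberg_neg, heisenberg_neg_time, AlgEquiv.apply_symm_apply]
  rw [hback, norm_heisenberg hKsa]
  simpa [abs_of_nonneg ht] using hint

end CStarAlgebra

section Support

variable {d L q : ℕ}

theorem _root_.Lattice.SupportedOn.apply_eq_zero {S : Finset (Site d L)} {A : Op d L q}
    (hA : SupportedOn S A) {x : Site d L} (hx : x ∉ S) {σ τ : Site d L → Fin q} (h : σ x ≠ τ x) :
    A σ τ = 0 :=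
  let ⟨_, ha⟩ := hA
  (ha σ τ).2 ⟨x, hx, h⟩

theorem _root_.Lattice.SupportedOn.apply_congr {S : Finset (Site d L)} {A : Op d L q}
    (hA : SupportedOn S A) {σ τ σ' τ' : Site d L → Fin q} (hστ : ∀ x ∉ S, σ x = τ x)
    (hστ' : ∀ x ∉ S, σ' x = τ' x) (hσ : ∀ x ∈ S, σ x = σ' x) (hτ : ∀ x ∈ S, τ x = τ' x) :
    A σ τ = A σ' τ' := by
  obtain ⟨a, ha⟩ := hA
  rw [(ha σ τ).1 hστ, (ha σ' τ').1 hστ']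
  exact congrArg₂ a (funext fun x => hσ x x.2) (funext fun x => hτ x x.2)

/-- In a product of operators with disjoint supports only one intermediate configuration
contributes: the one on which the first factor has already acted and the second has not. -/
theorem _root_.Lattice.SupportedOn.mul_apply {S T : Finset (Site d L)} {A B : Op d L q}
    (hA : SupportedOn S A) (hB : SupportedOn T B) (h : Disjoint S T) (σ τ : Site d L → Fin q) :
    (A * B) σ τ = A σ (S.piecewise τ σ) * B (S.piecewise τ σ) τ := by
  refine Finset.sum_eq_single _ (fun ρ _ hρ => ?_) (by simp)
  contrapose! hρ
  obtain ⟨hA0, hB0⟩ := mul_ne_zero_iff.1 hρ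
  ext1 x
  by_cases hx : x ∈ S
  · rw [Finset.piecewise_eq_of_mem _ _ _ hx]
    exact not_not.1 (mt (hB.apply_eq_zero (Finset.disjoint_left.1 h hx)) hB0)
  · rw [Finset.piecewise_eq_of_notMem _ _ _ hx]
    exact (not_not.1 (mt (hA.apply_eq_zero hx) hA0)).symm

theorem _root_.Lattice.SupportedOn.commute {S T : Finset (Site d L)} {A B : Op d L q}
    (hA : SupportedOn S A) (hB : SupportedOn T B) (h : Disjoint S T) : Commute A B := by
  have hS {x} (hx : x ∈ S) : x ∉ T := Finset.disjoint_left.1 h hx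
  have hT {x} (hx : x ∈ T) : x ∉ S := Finset.disjoint_right.1 h hx
  ext σ τ
  rw [hA.mul_apply hB h, hB.mul_apply hA h.symm, mul_comm]
  by_cases hστ : ∃ x, x ∉ S ∧ x ∉ T ∧ σ x ≠ τ x
  · obtain ⟨x, hxS, hxT, hne⟩ := hστ
    rw [hB.apply_eq_zero hxT (by simpa [hxS] using hne),
      hA.apply_eq_zero hxS (σ := T.piecewise τ σ) (by simpa [hxT] using hne), zero_mul, mul_zero]
  · push Not at hστ
    congr 1
    · refine hB.apply_congr (fun x hx => ?_) (fun x hx => by simp [hx])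
        (fun x hx => by simp [hT hx]) (fun x hx => by simp [hx])
      by_cases hxS : x ∈ S
      · simp [hxS]
      · simp [hxS, hστ x hxS hx]
    · refine hA.apply_congr (fun x hx => by simp [hx]) (fun x hx => ?_)
        (fun x hx => by simp [hS hx]) (fun x hx => by simp [hx])
      by_cases hxT : x ∈ T
      · simp [hxT]
      · simp [hxT, hστ x hx hxT]

/-- The matrix unit `|i⟩⟨j|` acting at the site `x`; an operator is supported on `S` exactly when
it commutes with these for all `x ∉ S`, see `supportedOn_iff_commute_siteUnit`. -/
def siteUnit (x : Site d L) (i j : Fin q) : Op d L q :=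
  Matrix.of fun σ τ => if σ x = i ∧ τ = Function.update σ x j then 1 else 0

theorem siteUnit_mul_apply (x : Site d L) (i j : Fin q) (A : Op d L q) (σ τ) :
    (siteUnit x i j * A) σ τ = if σ x = i then A (Function.update σ x j) τ else 0 := by
  rw [Matrix.mul_apply, Finset.sum_eq_single (Function.update σ x j)]
  · simp [siteUnit]
  · intro ρ _ h
    simp [siteUnit, h]
  · simp

theorem mul_siteUnit_apply (x : Site d L) (i j : Fin q) (A : Op d L q) (σ τ) :
    (A * siteUnit x i j) σ τ = if τ x = j then A σ (Function.update τ x i) else 0 := by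
  have hunit (ρ) : siteUnit x i j ρ τ = if τ x = j ∧ ρ = Function.update τ x i then 1 else 0 := by
    refine if_congr ⟨?_, ?_⟩ rfl rfl
    · rintro ⟨rfl, rfl⟩
      simp
    · rintro ⟨rfl, rfl⟩
      simp
  simp only [Matrix.mul_apply, hunit, ite_and]
  split_ifs <;> simp

theorem supportedOn_siteUnit (x : Site d L) (i j : Fin q) :
    SupportedOn {x} (siteUnit x i j) := by
  refine ⟨fun s t => if s ⟨x, by simp⟩ = i ∧ t ⟨x, by simp⟩ = j then 1 else 0,
    fun σ τ => ⟨fun h => ?_, ?_⟩⟩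
  · have : τ = Function.update σ x j ↔ τ x = j :=
      ⟨fun hτ => by simp [hτ], fun hτ => Function.eq_update_iff.2
        ⟨hτ, fun y hy => (h y (by simpa using hy)).symm⟩⟩
    simp [siteUnit, this]
  · rintro ⟨y, hy, hne⟩
    refine if_neg fun h => hne ?_
    rw [h.2, Function.update_of_ne (by simpa using hy)]

theorem apply_eq_zero_of_commute_siteUnit {A : Op d L q} {x : Site d L}
    (h : ∀ i j, Commute A (siteUnit x i j)) {σ τ : Site d L → Fin q} (hne : σ x ≠ τ x) :
    A σ τ = 0 := by
  have := congrFun₂ (h (τ x) (τ x)).eq σ τ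
  rw [mul_siteUnit_apply, siteUnit_mul_apply, if_pos rfl, if_neg hne] at this
  simpa using this

theorem apply_update_of_commute_siteUnit {A : Op d L q} {x : Site d L}
    (h : ∀ i j, Commute A (siteUnit x i j)) {σ τ : Site d L → Fin q} (he : σ x = τ x) (j : Fin q) :
    A (Function.update σ x j) (Function.update τ x j) = A σ τ := by
  have := congrFun₂ (h (τ x) j).eq σ (Function.update τ x j)
  rw [mul_siteUnit_apply, siteUnit_mul_apply, if_pos (by simp), if_pos he] at this
  simpa using this.symm

theorem apply_piecewise_of_commute_siteUnit {A : Op d L q} {R : Finset (Site d L)}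
    (h : ∀ x ∈ R, ∀ i j, Commute A (siteUnit x i j)) {σ τ : Site d L → Fin q}
    (he : ∀ x ∈ R, σ x = τ x) (ρ : Site d L → Fin q) :
    A (R.piecewise ρ σ) (R.piecewise ρ τ) = A σ τ := by
  induction R using Finset.induction_on with
  | empty => simp
  | insert x R hx ih =>
    rw [Finset.forall_mem_insert] at h he
    rw [Finset.piecewise_insert, Finset.piecewise_insert,
      apply_update_of_commute_siteUnit h.1 (by simp [hx, he.1]), ih h.2 he.2]

theorem supportedOn_iff_commute_siteUnit {S : Finset (Site d L)} {A : Op d L q} :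
    SupportedOn S A ↔ ∀ x ∉ S, ∀ i j, Commute A (siteUnit x i j) := by
  refine ⟨fun hA x hx i j => hA.commute (supportedOn_siteUnit x i j) (by simpa using hx),
    fun h => ?_⟩
  rcases isEmpty_or_nonempty (Site d L → Fin q) with he | ⟨⟨ρ⟩⟩
  · exact ⟨0, fun σ => he.elim σ⟩
  refine ⟨fun s t => A (fun x => if hx : x ∈ S then s ⟨x, hx⟩ else ρ x)
    (fun x => if hx : x ∈ S then t ⟨x, hx⟩ else ρ x), fun σ τ => ⟨fun hστ => ?_, ?_⟩⟩
  · refine (apply_piecewise_of_commute_siteUnit (R := Sᶜ) (by simpa using h) (by simpa using hστ)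
      ρ).symm.trans ?_
    congr 1 <;> ext x <;> by_cases hx : x ∈ S <;> simp [hx]
  · rintro ⟨x, hx, hne⟩
    exact apply_eq_zero_of_commute_siteUnit (h x hx) hne

/-- The algebra of the operators supported on `S`. -/
def localAlgebra (q : ℕ) (S : Finset (Site d L)) : Subalgebra ℂ (Op d L q) :=
  Subalgebra.centralizer ℂ {U | ∃ x ∉ S, ∃ i j, U = siteUnit x i j}

theorem mem_localAlgebra {S : Finset (Site d L)} {A : Op d L q} :
    A ∈ localAlgebra q S ↔ SupportedOn S A := by
  rw [supportedOn_iff_commute_siteUnit, localAlgebra, Subalgebra.mem_centralizer_iff]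
  refine ⟨fun h x hx i j => (h _ ⟨x, hx, i, j, rfl⟩).symm, ?_⟩
  rintro h _ ⟨x, hx, i, j, rfl⟩
  exact (h x hx i j).eq.symm

theorem supportedOn_zero (S : Finset (Site d L)) : SupportedOn S (0 : Op d L q) :=
  mem_localAlgebra.1 (zero_mem _)

theorem _root_.Lattice.SupportedOn.lie {S : Finset (Site d L)} {A B : Op d L q}
    (hA : SupportedOn S A) (hB : SupportedOn S B) : SupportedOn S ⁅A, B⁆ := by
  rw [← mem_localAlgebra] at hA hB ⊢
  exact sub_mem (mul_mem hA hB) (mul_mem hB hA)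

theorem _root_.Lattice.SupportedOn.mono {S T : Finset (Site d L)} {A : Op d L q}
    (hA : SupportedOn S A) (h : S ⊆ T) : SupportedOn T A := by
  rw [supportedOn_iff_commute_siteUnit] at hA ⊢
  exact fun x hx => hA x fun hxS => hx (h hxS)

theorem supportedOn_univ (A : Op d L q) : SupportedOn Finset.univ A :=
  supportedOn_iff_commute_siteUnit.2 fun x hx => absurd (Finset.mem_univ x) hx

theorem _root_.Lattice.SupportedOn.heisenberg {S : Finset (Site d L)} {H A : Op d L q}
    (hH : SupportedOn S H) (hA : SupportedOn S A) (t : ℝ) : SupportedOn S (heisenberg H t A) := by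
  rw [supportedOn_iff_commute_siteUnit] at hH hA ⊢
  intro x hx i j
  have hU := commute_propagator (hH x hx i j) t
  exact (hU.mul_left (hA x hx i j)).mul_left hU.units_inv_left

end Support

section Connected

variable {d L : ℕ}

instance : Nonempty (Site d L) := ⟨fun _ => ⟨0, by simp⟩⟩

theorem _root_.Lattice.IsConn.nonempty {S : Finset (Site d L)} (h : IsConn S) : S.Nonempty := by
  obtain ⟨x⟩ := SimpleGraph.Connected.nonempty h
  exact ⟨x, x.2⟩

theorem _root_.Lattice.IsConn.union {S T : Finset (Site d L)} (hS : IsConn S) (hT : IsConn T)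
    (h : ¬ Disjoint S T) : IsConn (S ∪ T) := by
  obtain ⟨x, hxS, hxT⟩ := Finset.not_disjoint_iff.1 h
  rw [IsConn, Finset.coe_union]
  exact SimpleGraph.induce_union_connected hS.preconnected hT.preconnected
    ⟨x, by exact_mod_cast hxS, by exact_mod_cast hxT⟩

theorem dist_le_one_of_adj {x y : Site d L} (h : (graph d L).Adj x y) : dist x y ≤ 1 := by
  refine (dist_pi_le_iff zero_le_one).2 fun i => ?_
  have hsum : ∑ i, |(x i : ℤ) - (y i : ℤ)| = 1 := h
  rw [Subtype.dist_eq, Int.dist_eq]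
  exact_mod_cast (Finset.single_le_sum (f := fun i => |(x i : ℤ) - (y i : ℤ)|)
    (fun i _ => abs_nonneg _) (Finset.mem_univ i)).trans_eq hsum

theorem dist_le_length {S : Set (Site d L)} {u v : S} (p : ((graph d L).induce S).Walk u v) :
    dist (u : Site d L) v ≤ p.length := by
  induction p with
  | nil => simp
  | @cons u v w h p ih =>
    calc dist (u : Site d L) w ≤ dist (u : Site d L) v + dist (v : Site d L) w := dist_triangle ..
      _ ≤ 1 + p.length := add_le_add (dist_le_one_of_adj h) ih
      _ = (p.cons h).length := by rw [SimpleGraph.Walk.length_cons]; push_cast; ring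

theorem _root_.Lattice.IsConn.dist_le {S : Finset (Site d L)} (hS : IsConn S) {x y : Site d L}
    (hx : x ∈ S) (hy : y ∈ S) : dist x y ≤ S.card := by
  obtain ⟨p, hp⟩ := hS.exists_isPath ⟨x, hx⟩ ⟨y, hy⟩
  have hlen : p.length ≤ S.card := by simpa using hp.length_lt.le
  exact (dist_le_length p).trans (by exact_mod_cast hlen)

theorem exists_adj_dist_succ {x y : Site d L} (h : x ≠ y) :
    ∃ z, (graph d L).Adj x z ∧
      ∑ i, |(z i : ℤ) - y i| + 1 = ∑ i, |(x i : ℤ) - y i| := by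
  obtain ⟨i, hi⟩ := Function.ne_iff.1 h
  replace hi : (x i : ℤ) ≠ y i := fun h' => hi (Subtype.ext h')
  have hxi := (x i).2
  have hyi := (y i).2
  rw [Set.mem_Icc] at hxi hyi
  obtain ⟨m, hm, hxm, hmy⟩ : ∃ m : ℤ, m ∈ Set.Icc (-(L : ℤ)) L ∧ |(x i : ℤ) - m| = 1 ∧
      |m - y i| + 1 = |(x i : ℤ) - y i| := by
    rcases lt_or_gt_of_ne hi with hlt | hlt
    · exact ⟨x i + 1, ⟨by omega, by omega⟩, by simp, by
        rw [abs_of_nonpos (by omega), abs_of_nonpos (by omega)]; omega⟩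
    · exact ⟨x i - 1, ⟨by omega, by omega⟩, by simp, by
        rw [abs_of_nonneg (by omega), abs_of_nonneg (by omega)]; omega⟩
  set z : Site d L := Function.update x i ⟨m, hm⟩ with hz
  have hzi : (z i : ℤ) = m := by simp [hz]
  have hzj : ∀ j ≠ i, z j = x j := fun j hj => by simp [hz, hj]
  refine ⟨z, ?_, ?_⟩
  · change ∑ j, |(x j : ℤ) - z j| = 1
    rw [Finset.sum_eq_single i (fun j _ hj => by simp [hzj j hj]) (by simp), hzi, hxm]
  · rw [← Finset.add_sum_erase _ _ (Finset.mem_univ i),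
      ← Finset.add_sum_erase _ (fun j => |(x j : ℤ) - y j|) (Finset.mem_univ i), hzi, ← hmy,
      Finset.sum_congr rfl fun j hj => by rw [hzj j (Finset.ne_of_mem_erase hj)]]
    ring

theorem graph_connected : (graph d L).Connected := by
  refine ⟨fun x y => ?_⟩
  induction h : (∑ i, |(x i : ℤ) - y i|).toNat generalizing x with
  | zero =>
    obtain rfl : x = y := by
      by_contra hne
      obtain ⟨z, -, hz⟩ := exists_adj_dist_succ hne
      have : 0 ≤ ∑ i, |(z i : ℤ) - y i| := Finset.sum_nonneg fun i _ => abs_nonneg _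
      omega
    exact SimpleGraph.Reachable.refl x
  | succ n ih =>
    have hne : x ≠ y := by
      rintro rfl
      simp at h
    obtain ⟨z, hxz, hz⟩ := exists_adj_dist_succ hne
    exact hxz.reachable.trans (ih z (by omega))

theorem isConn_univ : IsConn (Finset.univ : Finset (Site d L)) := by
  rw [IsConn, Finset.coe_univ]
  exact (SimpleGraph.induceUnivIso (graph d L)).connected_iff.2 graph_connected

end Connected

end Prethermal

namespace Lattice.ExtOp

open Prethermal Finset

variable {d L q : ℕ}

section NormedSpace

theorem term_injective : Function.Injective (term : ExtOp d L q → Finset (Site d L) → Op d L q)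
  | ⟨_, _, _⟩, ⟨_, _, _⟩, rfl => rfl

theorem ext {A B : ExtOp d L q} (h : ∀ S, A.term S = B.term S) : A = B :=
  term_injective (funext h)

/-- The families of local terms of extensive local operators, as a subspace of all families. -/
def termSubmodule (d L q : ℕ) : Submodule ℂ (Finset (Site d L) → Op d L q) where
  carrier := {A | ∀ S, A S ∈ localAlgebra q S ∧ (¬ IsConn S → A S = 0)}
  add_mem' hA hB S :=
    ⟨add_mem (hA S).1 (hB S).1, fun h => by rw [Pi.add_apply, (hA S).2 h, (hB S).2 h, add_zero]⟩
  zero_mem' S := ⟨zero_mem _, fun _ => rfl⟩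
  smul_mem' c A hA S :=
    ⟨Subalgebra.smul_mem _ (hA S).1 c, fun h => by rw [Pi.smul_apply, (hA S).2 h, smul_zero]⟩

/-- An extensive local operator is the family of its local terms; this transports the vector space
structure. -/
def equivTermSubmodule : ExtOp d L q ≃ termSubmodule d L q where
  toFun A := ⟨A.term, fun S => ⟨mem_localAlgebra.2 (A.supported S), A.term_eq_zero S⟩⟩
  invFun A := ⟨A, fun S => mem_localAlgebra.1 (A.2 S).1, fun S => (A.2 S).2⟩
  left_inv _ := rfl
  right_inv _ := rfl

/-- The sup norm of the family of local terms. It serves only to provide the topology of the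
finite-dimensional space of extensive local operators; the estimates are in terms of
`ExtOp.norm`. -/
instance : NormedAddCommGroup (ExtOp d L q) := equivTermSubmodule.normedAddCommGroup

instance : NormedSpace ℂ (ExtOp d L q) := equivTermSubmodule.normedSpace ℂ

instance : FiniteDimensional ℂ (ExtOp d L q) :=
  (equivTermSubmodule.linearEquiv ℂ).symm.finiteDimensional

instance : CompleteSpace (ExtOp d L q) := FiniteDimensional.complete ℂ _

@[simp] theorem term_add (A B : ExtOp d L q) (S) : (A + B).term S = A.term S + B.term S := rfl
@[simp] theorem term_neg (A : ExtOp d L q) (S) : (-A).term S = -A.term S := rfl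
@[simp] theorem term_smul (c : ℂ) (A : ExtOp d L q) (S) : (c • A).term S = c • A.term S := rfl
@[simp] theorem term_zero (S) : (0 : ExtOp d L q).term S = 0 := rfl

theorem continuous_term (S : Finset (Site d L)) : Continuous fun A : ExtOp d L q => A.term S :=
  LinearMap.continuous_of_finiteDimensional
    (⟨⟨fun A => A.term S, fun _ _ => rfl⟩, fun _ _ => rfl⟩ : ExtOp d L q →ₗ[ℂ] Op d L q)

/-- `ExtOp.op` as a continuous linear map. -/
def opL : ExtOp d L q →L[ℂ] Op d L q :=
  LinearMap.toContinuousLinearMap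
    { toFun := op
      map_add' := fun _ _ => sum_add_distrib
      map_smul' := fun c A => (smul_sum (r := c) (f := A.term)).symm }

@[simp] theorem op_add (A B : ExtOp d L q) : (A + B).op = A.op + B.op := map_add opL A B
@[simp] theorem op_neg (A : ExtOp d L q) : (-A).op = -A.op := map_neg opL A
@[simp] theorem op_smul (c : ℂ) (A : ExtOp d L q) : (c • A).op = c • A.op := map_smul opL c A
@[simp] theorem op_zero : (0 : ExtOp d L q).op = 0 := map_zero opL

end NormedSpace

section SelfAdj

theorem SelfAdj.op {A : ExtOp d L q} (h : A.SelfAdj) : IsSelfAdjoint A.op :=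
  sum_induction _ _ (fun _ _ => IsSelfAdjoint.add) (.zero _) fun S _ => h S

theorem SelfAdj.zero : (0 : ExtOp d L q).SelfAdj := fun _ => .zero _

theorem SelfAdj.add {A B : ExtOp d L q} (hA : A.SelfAdj) (hB : B.SelfAdj) : (A + B).SelfAdj :=
  fun S => (hA S).add (hB S)

theorem SelfAdj.sub {A B : ExtOp d L q} (hA : A.SelfAdj) (hB : B.SelfAdj) : (A - B).SelfAdj :=
  fun S => (hA S).sub (hB S)

theorem SelfAdj.neg {A : ExtOp d L q} (hA : A.SelfAdj) : (-A).SelfAdj :=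
  fun S => (hA S).neg

theorem SelfAdj.smul {A : ExtOp d L q} {c : ℂ} (hc : IsSelfAdjoint c) (hA : A.SelfAdj) :
    (c • A).SelfAdj :=
  fun S => hc.smul (hA S)

theorem isClosed_selfAdj : IsClosed {A : ExtOp d L q | A.SelfAdj} := by
  simp only [SelfAdj, Set.ofPred_forall]
  exact isClosed_iInter fun S => isClosed_eq (continuous_star.comp (continuous_term S))
    (continuous_term S)

end SelfAdj

section LocalNorm

/-- The sum over the sets containing the site `x` in the definition of `ExtOp.norm`. -/
def siteNorm (μ : ℝ) (A : ExtOp d L q) (x : Site d L) : ℝ :=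
  ∑ S : Finset (Site d L) with x ∈ S, ‖A.term S‖ * Real.exp (μ * S.card)

theorem siteNorm_le_norm (μ : ℝ) (A : ExtOp d L q) (x : Site d L) : siteNorm μ A x ≤ A.norm μ :=
  le_ciSup (f := fun x => siteNorm μ A x) (Set.finite_range _).bddAbove x

theorem norm_le_iff {μ C : ℝ} {A : ExtOp d L q} : A.norm μ ≤ C ↔ ∀ x, siteNorm μ A x ≤ C :=
  ⟨fun h x => (siteNorm_le_norm μ A x).trans h, ciSup_le⟩

theorem norm_nonneg (μ : ℝ) (A : ExtOp d L q) : 0 ≤ A.norm μ :=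
  Real.iSup_nonneg fun _ => sum_nonneg fun _ _ => by positivity

theorem norm_le_mul_norm {μ ν c : ℝ} {A B : ExtOp d L q} (hc : 0 ≤ c)
    (h : ∀ S, ‖A.term S‖ * Real.exp (μ * S.card) ≤ c * (‖B.term S‖ * Real.exp (ν * S.card))) :
    A.norm μ ≤ c * B.norm ν :=
  norm_le_iff.2 fun x => calc
    siteNorm μ A x ≤ c * siteNorm ν B x := by
      rw [siteNorm, siteNorm, mul_sum]
      exact sum_le_sum fun S _ => h S
    _ ≤ c * B.norm ν := mul_le_mul_of_nonneg_left (siteNorm_le_norm ν B x) hc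

theorem norm_mono {μ ν : ℝ} (h : μ ≤ ν) (A : ExtOp d L q) : A.norm μ ≤ A.norm ν := by
  simpa using norm_le_mul_norm (μ := μ) (ν := ν) (A := A) (B := A) zero_le_one fun S => by
    rw [one_mul]
    gcongr

protected theorem norm_add_le (μ : ℝ) (A B : ExtOp d L q) :
    (A + B).norm μ ≤ A.norm μ + B.norm μ :=
  norm_le_iff.2 fun x => calc
    siteNorm μ (A + B) x ≤ siteNorm μ A x + siteNorm μ B x := by
      rw [siteNorm, siteNorm, siteNorm, ← sum_add_distrib]
      refine sum_le_sum fun S _ => ?_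
      rw [← add_mul, term_add]
      exact mul_le_mul_of_nonneg_right (_root_.norm_add_le _ _) (Real.exp_pos _).le
    _ ≤ _ := add_le_add (siteNorm_le_norm _ _ _) (siteNorm_le_norm _ _ _)

protected theorem norm_smul_le (μ : ℝ) (c : ℂ) (A : ExtOp d L q) :
    (c • A).norm μ ≤ ‖c‖ * A.norm μ :=
  norm_le_mul_norm (_root_.norm_nonneg c) fun S => by rw [term_smul, norm_smul, mul_assoc]

@[simp] protected theorem norm_neg (μ : ℝ) (A : ExtOp d L q) : (-A).norm μ = A.norm μ := by
  simp [norm]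

protected theorem norm_sub_le (μ : ℝ) (A B : ExtOp d L q) :
    (A - B).norm μ ≤ A.norm μ + B.norm μ := by
  rw [sub_eq_add_neg, ← B.norm_neg μ]
  exact ExtOp.norm_add_le μ A (-B)

@[simp] protected theorem norm_zero (μ : ℝ) : (0 : ExtOp d L q).norm μ = 0 := by
  simp [norm]

theorem isClosed_norm_le (μ C : ℝ) : IsClosed {A : ExtOp d L q | A.norm μ ≤ C} := by
  simp only [norm_le_iff, Set.ofPred_forall]
  exact isClosed_iInter fun x => isClosed_le
    (continuous_finsetSum _ fun S _ => (continuous_term S).norm.mul continuous_const)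
    continuous_const

theorem norm_le_of_hasSum {μ C : ℝ} {f : ℕ → ExtOp d L q} {A : ExtOp d L q} (hf : HasSum f A)
    {c : ℕ → ℝ} (hc : HasSum c C) (h : ∀ k, (f k).norm μ ≤ c k) : A.norm μ ≤ C := by
  refine (isClosed_norm_le μ C).mem_of_tendsto hf (.of_forall fun s => ?_)
  calc (∑ k ∈ s, f k).norm μ ≤ ∑ k ∈ s, (f k).norm μ :=
        le_sum_of_subadditive (norm μ) (ExtOp.norm_zero μ).le (ExtOp.norm_add_le μ) s f
    _ ≤ ∑ k ∈ s, c k := sum_le_sum fun k _ => h k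
    _ ≤ C := sum_le_hasSum s (fun k _ => (norm_nonneg μ (f k)).trans (h k)) hc

theorem norm_term_le {μ : ℝ} (hμ : 0 ≤ μ) (A : ExtOp d L q) (S : Finset (Site d L)) :
    ‖A.term S‖ ≤ Real.exp (-μ) * (‖A.term S‖ * Real.exp (μ * S.card)) := by
  by_cases hS : IsConn S
  · have hcard : (1 : ℝ) ≤ S.card := by exact_mod_cast hS.nonempty.card_pos
    calc ‖A.term S‖ ≤ ‖A.term S‖ * Real.exp (μ * S.card - μ) :=
          le_mul_of_one_le_right (_root_.norm_nonneg _) (Real.one_le_exp (by nlinarith))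
      _ = Real.exp (-μ) * (‖A.term S‖ * Real.exp (μ * S.card)) := by
          rw [sub_eq_neg_add, Real.exp_add, mul_left_comm]
  · simp [A.term_eq_zero S hS]

theorem sum_norm_term_le {μ : ℝ} (hμ : 0 ≤ μ) (A : ExtOp d L q) (x : Site d L) :
    ∑ S : Finset (Site d L) with x ∈ S, ‖A.term S‖ ≤ Real.exp (-μ) * A.norm μ :=
  calc ∑ S : Finset (Site d L) with x ∈ S, ‖A.term S‖ ≤ Real.exp (-μ) * siteNorm μ A x := by
        rw [siteNorm, mul_sum]
        exact sum_le_sum fun S _ => norm_term_le hμ A S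
    _ ≤ Real.exp (-μ) * A.norm μ := by gcongr; exact siteNorm_le_norm μ A x

theorem sum_card_mul_norm_term_le {μ : ℝ} (hμ : 0 ≤ μ) (A : ExtOp d L q) :
    ∑ S, (S.card : ℝ) * ‖A.term S‖ ≤ Fintype.card (Site d L) * (Real.exp (-μ) * A.norm μ) :=
  calc ∑ S, (S.card : ℝ) * ‖A.term S‖
      = ∑ x : Site d L, ∑ S : Finset (Site d L) with x ∈ S, ‖A.term S‖ := by
        simp_rw [sum_filter]
        rw [sum_comm]
        simp
    _ ≤ ∑ _x : Site d L, Real.exp (-μ) * A.norm μ := sum_le_sum fun x _ => sum_norm_term_le hμ A x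
    _ = Fintype.card (Site d L) * (Real.exp (-μ) * A.norm μ) := by simp

theorem norm_op_le {μ : ℝ} (hμ : 0 ≤ μ) (A : ExtOp d L q) :
    ‖A.op‖ ≤ Fintype.card (Site d L) * (Real.exp (-μ) * A.norm μ) := by
  refine (norm_sum_le _ _).trans ((sum_le_sum fun S _ => ?_).trans (sum_card_mul_norm_term_le hμ A))
  by_cases hS : IsConn S
  · exact le_mul_of_one_le_left (_root_.norm_nonneg _) (by exact_mod_cast hS.nonempty.card_pos)
  · simp [A.term_eq_zero S hS]

end LocalNorm

section Commutator

theorem sum_not_disjoint_le {ι : Type*} [Fintype ι] [DecidableEq ι] (S : Finset ι)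
    {b : Finset ι → ℝ} (hb : ∀ T, 0 ≤ b T) :
    ∑ T with ¬ Disjoint S T, b T ≤ ∑ y ∈ S, ∑ T with y ∈ T, b T := by
  simp_rw [sum_filter]
  rw [sum_comm]
  refine sum_le_sum fun T _ => ?_
  have hnonneg : ∀ y ∈ S, 0 ≤ if y ∈ T then b T else 0 := fun y _ => by
    split_ifs
    exacts [hb T, le_rfl]
  by_cases h : Disjoint S T
  · exact (if_neg (not_not.2 h)).trans_le (sum_nonneg hnonneg)
  · obtain ⟨y, hyS, hyT⟩ := not_disjoint_iff.1 h
    calc (if ¬ Disjoint S T then b T else 0) = if y ∈ T then b T else 0 := by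
          rw [if_pos h, if_pos hyT]
      _ ≤ ∑ y ∈ S, if y ∈ T then b T else 0 := single_le_sum hnonneg hyS

theorem sum_norm_lie_term_le {S : Finset (Site d L)} {a : Op d L q} (ha : SupportedOn S a) (μ : ℝ)
    (B : ExtOp d L q) :
    ∑ T, ‖⁅a, B.term T⁆‖ * Real.exp (μ * T.card) ≤ 2 * ‖a‖ * (S.card * B.norm μ) := by
  have hdisj (T : Finset (Site d L)) (hT : Disjoint S T) : ⁅a, B.term T⁆ = 0 :=
    (ha.commute (B.supported T) hT).lie_eq
  calc ∑ T, ‖⁅a, B.term T⁆‖ * Real.exp (μ * T.card)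
      = ∑ T with ¬ Disjoint S T, ‖⁅a, B.term T⁆‖ * Real.exp (μ * T.card) :=
        (sum_filter_of_ne (s := univ) (p := fun T => ¬ Disjoint S T)
          (f := fun T => ‖⁅a, B.term T⁆‖ * Real.exp (μ * T.card)) fun T _ hne hT => hne (by
            rw [hdisj T hT, _root_.norm_zero, zero_mul])).symm
    _ ≤ ∑ T with ¬ Disjoint S T, 2 * ‖a‖ * (‖B.term T‖ * Real.exp (μ * T.card)) :=
        sum_le_sum fun T _ => by
          rw [← mul_assoc]
          exact mul_le_mul_of_nonneg_right (norm_lie_le _ _) (Real.exp_pos _).le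
    _ ≤ 2 * ‖a‖ * ∑ y ∈ S, siteNorm μ B y := by
        rw [← mul_sum]
        gcongr
        exact sum_not_disjoint_le S fun T => by positivity
    _ ≤ 2 * ‖a‖ * (S.card * B.norm μ) := by
        rw [← nsmul_eq_mul]
        gcongr
        exact sum_le_card_nsmul _ _ _ fun y _ => siteNorm_le_norm μ B y

theorem norm_lie_op_le {S : Finset (Site d L)} {a : Op d L q} (ha : SupportedOn S a) {μ : ℝ}
    (hμ : 0 ≤ μ) (B : ExtOp d L q) :
    ‖⁅a, B.op⁆‖ ≤ 2 * ‖a‖ * (S.card * (Real.exp (-μ) * B.norm μ)) := by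
  have hterm (T : Finset (Site d L)) :
      ‖⁅a, B.term T⁆‖ ≤ Real.exp (-μ) * (‖⁅a, B.term T⁆‖ * Real.exp (μ * T.card)) := by
    by_cases hT : IsConn T
    · have hcard : (1 : ℝ) ≤ T.card := by exact_mod_cast hT.nonempty.card_pos
      rw [mul_left_comm, ← Real.exp_add]
      exact le_mul_of_one_le_right (_root_.norm_nonneg _) (Real.one_le_exp (by nlinarith))
    · simp [B.term_eq_zero T hT]
  calc ‖⁅a, B.op⁆‖ ≤ ∑ T, ‖⁅a, B.term T⁆‖ := by rw [op, lie_sum]; exact norm_sum_le _ _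
    _ ≤ Real.exp (-μ) * ∑ T, ‖⁅a, B.term T⁆‖ * Real.exp (μ * T.card) := by
        rw [mul_sum]
        exact sum_le_sum fun T _ => hterm T
    _ ≤ Real.exp (-μ) * (2 * ‖a‖ * (S.card * B.norm μ)) := by
        gcongr
        exact sum_norm_lie_term_le ha μ B
    _ = _ := by ring

theorem norm_lie_op_op_le {μ ν : ℝ} (hμ : 0 ≤ μ) (hν : 0 ≤ ν) (A B : ExtOp d L q) :
    ‖⁅A.op, B.op⁆‖ ≤ Fintype.card (Site d L) *
      (2 * (Real.exp (-μ) * A.norm μ) * (Real.exp (-ν) * B.norm ν)) := by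
  have hb : 0 ≤ Real.exp (-ν) * B.norm ν := mul_nonneg (Real.exp_pos _).le (norm_nonneg _ _)
  calc ‖⁅A.op, B.op⁆‖ ≤ ∑ S, ‖⁅A.term S, B.op⁆‖ := by
        conv_lhs => rw [op, sum_lie]
        exact norm_sum_le _ _
    _ ≤ ∑ S, 2 * (Real.exp (-ν) * B.norm ν) * (S.card * ‖A.term S‖) :=
        sum_le_sum fun S _ => (norm_lie_op_le (A.supported S) hν B).trans_eq (by ring)
    _ ≤ 2 * (Real.exp (-ν) * B.norm ν) *
          (Fintype.card (Site d L) * (Real.exp (-μ) * A.norm μ)) := by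
        rw [← mul_sum]
        gcongr
        exact sum_card_mul_norm_term_le hμ A
    _ = _ := by ring

/-- The commutator of extensive local operators, with `[A_S, B_T]` a local term on `S ∪ T`; it
vanishes unless `S` and `T` intersect, so that `S ∪ T` is connected. -/
instance : Bracket (ExtOp d L q) (ExtOp d L q) where
  bracket A B :=
    { term := fun S => ∑ p : Finset (Site d L) × Finset (Site d L) with p.1 ∪ p.2 = S,
        ⁅A.term p.1, B.term p.2⁆
      supported := fun S => by
        refine mem_localAlgebra.1 (sum_mem fun p hp => mem_localAlgebra.2 ?_)
        obtain rfl := (mem_filter.1 hp).2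
        exact ((A.supported p.1).mono subset_union_left).lie
          ((B.supported p.2).mono subset_union_right)
      term_eq_zero := fun S hS => by
        refine sum_eq_zero fun p hp => ?_
        obtain rfl := (mem_filter.1 hp).2
        by_cases h₁ : IsConn p.1
        · by_cases h₂ : IsConn p.2
          · by_cases h : Disjoint p.1 p.2
            · exact ((A.supported p.1).commute (B.supported p.2) h).lie_eq
            · exact absurd (h₁.union h₂ h) hS
          · rw [B.term_eq_zero p.2 h₂, lie_zero]
        · rw [A.term_eq_zero p.1 h₁, zero_lie] }

theorem term_lie (A B : ExtOp d L q) (S : Finset (Site d L)) :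
    ⁅A, B⁆.term S = ∑ p : Finset (Site d L) × Finset (Site d L) with p.1 ∪ p.2 = S,
      ⁅A.term p.1, B.term p.2⁆ := rfl

theorem op_lie (A B : ExtOp d L q) : ⁅A, B⁆.op = ⁅A.op, B.op⁆ := by
  simp only [op, term_lie]
  rw [sum_fiberwise, Fintype.sum_prod_type, sum_lie_sum]

theorem OnSite.term_lie {N : ExtOp d L q} (hN : N.OnSite) (A : ExtOp d L q)
    (S : Finset (Site d L)) : ⁅A, N⁆.term S = ⁅A.term S, N.op⁆ := by
  have hunion (S₁ T : Finset (Site d L)) (h : ⁅A.term S₁, N.term T⁆ ≠ 0) : S₁ ∪ T = S₁ := by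
    contrapose! h
    by_cases hT : T.card = 1
    · obtain ⟨x, rfl⟩ := card_eq_one.1 hT
      have hx : x ∉ S₁ := fun hx => h (union_eq_left.2 (singleton_subset_iff.2 hx))
      exact ((A.supported S₁).commute (N.supported {x}) (disjoint_singleton_right.2 hx)).lie_eq
    · rw [hN T hT, lie_zero]
  rw [ExtOp.term_lie, op, lie_sum, sum_filter, Fintype.sum_prod_type, sum_eq_single S]
  · refine sum_congr rfl fun T _ => ?_
    split_ifs with h
    · rfl
    · exact (not_not.1 (mt (hunion S T) h)).symm
  · intro S₁ _ hne
    refine sum_eq_zero fun T _ => ite_eq_right_iff.2 fun h => ?_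
    by_contra hlie
    exact hne ((hunion S₁ T hlie).symm.trans h)
  · simp

theorem SelfAdj.I_smul_lie {A B : ExtOp d L q} (hA : A.SelfAdj) (hB : B.SelfAdj) :
    (Complex.I • ⁅A, B⁆).SelfAdj := by
  intro S
  rw [term_smul, ExtOp.term_lie, smul_sum]
  exact sum_induction _ _ (fun _ _ => IsSelfAdjoint.add) (.zero _) fun p _ =>
    isSelfAdjoint_I_smul_lie (hA p.1) (hB p.2)

theorem natCast_mul_exp_le {η : ℝ} (hη : 0 < η) (ν : ℝ) (n : ℕ) :
    n * Real.exp ((ν - η) * n) ≤ (Real.exp 1 * η)⁻¹ * Real.exp (ν * n) := by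
  have hlin : Real.exp 1 * η * n ≤ Real.exp (η * n) := by
    have := mul_le_mul_of_nonneg_left (Real.add_one_le_exp (η * n - 1)) (Real.exp_pos 1).le
    rw [← Real.exp_add] at this
    simpa [mul_assoc] using this
  rw [inv_mul_eq_div, le_div_iff₀ (by positivity)]
  calc n * Real.exp ((ν - η) * n) * (Real.exp 1 * η)
      = Real.exp 1 * η * n * Real.exp ((ν - η) * n) := by ring
    _ ≤ Real.exp (η * n) * Real.exp ((ν - η) * n) := by gcongr
    _ = Real.exp (ν * n) := by rw [← Real.exp_add]; ring_nf

/-- The loss `η` in the weight pays for the factor `|S|` coming from the choice of a site of `S`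
at which the second set meets it. -/
theorem sum_norm_lie_term_term_le {ν η : ℝ} (hη : 0 < η) (A B : ExtOp d L q) (x : Site d L) :
    ∑ S with x ∈ S, ∑ T, ‖⁅A.term S, B.term T⁆‖ * (Real.exp ((ν - η) * S.card) *
      Real.exp ((ν - η) * T.card)) ≤ 2 * ((Real.exp 1 * η)⁻¹ * A.norm ν * B.norm ν) :=
  calc _ ≤ ∑ S with x ∈ S, Real.exp ((ν - η) * S.card) *
          (2 * ‖A.term S‖ * (S.card * B.norm ν)) := by
        refine sum_le_sum fun S _ => ?_
        simp_rw [mul_left_comm _ (Real.exp ((ν - η) * S.card)), ← mul_sum]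
        gcongr
        refine (sum_norm_lie_term_le (A.supported S) (ν - η) B).trans ?_
        gcongr
        exact norm_mono (sub_le_self ν hη.le) B
    _ ≤ ∑ S with x ∈ S, 2 * ((Real.exp 1 * η)⁻¹ * B.norm ν) *
          (‖A.term S‖ * Real.exp (ν * S.card)) := by
        refine sum_le_sum fun S _ => ?_
        have := mul_le_mul_of_nonneg_left (natCast_mul_exp_le hη ν S.card)
          (mul_nonneg (mul_nonneg zero_le_two (_root_.norm_nonneg (A.term S))) (norm_nonneg ν B))
        calc _ = 2 * ‖A.term S‖ * B.norm ν * (S.card * Real.exp ((ν - η) * S.card)) := by ring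
          _ ≤ _ := this
          _ = _ := by ring
    _ ≤ 2 * ((Real.exp 1 * η)⁻¹ * B.norm ν) * A.norm ν := by
        rw [← mul_sum]
        exact mul_le_mul_of_nonneg_left (siteNorm_le_norm ν A x)
          (mul_nonneg zero_le_two (mul_nonneg (by positivity) (norm_nonneg ν B)))
    _ = _ := by ring

theorem siteNorm_lie_le {μ : ℝ} (hμ : 0 ≤ μ) (A B : ExtOp d L q) (x : Site d L) :
    siteNorm μ ⁅A, B⁆ x ≤ ∑ p : Finset (Site d L) × Finset (Site d L) with x ∈ p.1 ∪ p.2,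
      ‖⁅A.term p.1, B.term p.2⁆‖ * (Real.exp (μ * p.1.card) * Real.exp (μ * p.2.card)) := by
  have hunion (S T : Finset (Site d L)) :
      Real.exp (μ * (S ∪ T).card) ≤ Real.exp (μ * S.card) * Real.exp (μ * T.card) := by
    rw [← Real.exp_add, ← mul_add]
    gcongr
    exact_mod_cast card_union_le S T
  calc siteNorm μ ⁅A, B⁆ x
      ≤ ∑ S with x ∈ S, ∑ p : Finset (Site d L) × Finset (Site d L) with p.1 ∪ p.2 = S,
        ‖⁅A.term p.1, B.term p.2⁆‖ * Real.exp (μ * S.card) :=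
        sum_le_sum fun S _ => by
          rw [← sum_mul]
          gcongr
          exact norm_sum_le _ _
    _ = ∑ p : Finset (Site d L) × Finset (Site d L) with x ∈ p.1 ∪ p.2,
        ‖⁅A.term p.1, B.term p.2⁆‖ * Real.exp (μ * (p.1 ∪ p.2).card) := by
        rw [← sum_fiberwise_of_maps_to (t := ({S | x ∈ S} : Finset (Finset (Site d L))))
          (g := fun p : Finset (Site d L) × Finset (Site d L) => p.1 ∪ p.2)
          fun p hp => by simpa using hp]
        refine sum_congr rfl fun S hS => ?_
        rw [filter_filter]
        refine sum_congr (filter_congr fun p _ => ?_) fun p hp => ?_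
        · exact ⟨fun h => ⟨h ▸ (mem_filter.1 hS).2, h⟩, fun h => h.2⟩
        · rw [(mem_filter.1 hp).2.2]
    _ ≤ _ := sum_le_sum fun p _ => by gcongr; exact hunion p.1 p.2

protected theorem norm_lie_le {ν η : ℝ} (hη : 0 < η) (hν : η ≤ ν) (A B : ExtOp d L q) :
    ⁅A, B⁆.norm (ν - η) ≤ 4 / (Real.exp 1 * η) * A.norm ν * B.norm ν := by
  refine norm_le_iff.2 fun x => ?_
  set w : Finset (Site d L) × Finset (Site d L) → ℝ := fun p => ‖⁅A.term p.1, B.term p.2⁆‖ *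
    (Real.exp ((ν - η) * p.1.card) * Real.exp ((ν - η) * p.2.card)) with hw
  have hfst : ∑ p with x ∈ p.1, w p ≤ 2 * ((Real.exp 1 * η)⁻¹ * A.norm ν * B.norm ν) := by
    refine le_of_eq_of_le ?_ (sum_norm_lie_term_term_le hη A B x)
    rw [sum_filter, Fintype.sum_prod_type, sum_filter]
    refine sum_congr rfl fun S _ => ?_
    split_ifs
    · rfl
    · exact sum_const_zero
  have hsnd : ∑ p with x ∈ p.2, w p ≤ 2 * ((Real.exp 1 * η)⁻¹ * B.norm ν * A.norm ν) := by
    refine le_of_eq_of_le ?_ (sum_norm_lie_term_term_le hη B A x)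
    rw [sum_filter, Fintype.sum_prod_type_right, sum_filter]
    refine sum_congr rfl fun T _ => ?_
    split_ifs
    · refine sum_congr rfl fun S _ => ?_
      rw [hw, ← lie_skew, _root_.norm_neg, mul_comm (Real.exp _)]
    · exact sum_const_zero
  calc siteNorm (ν - η) ⁅A, B⁆ x ≤ ∑ p with x ∈ p.1 ∪ p.2, w p :=
        siteNorm_lie_le (sub_nonneg.2 hν) A B x
    _ ≤ ∑ p with x ∈ p.1, w p + ∑ p with x ∈ p.2, w p := by
        simp_rw [mem_union, filter_or]
        rw [← sum_union_inter]
        exact le_add_of_nonneg_right (sum_nonneg fun p _ => by positivity)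
    _ ≤ _ := add_le_add hfst hsnd
    _ = _ := by ring

end Commutator

end Lattice.ExtOp

namespace Prethermal

section ExpSeries

variable {E F : Type*} [NormedAddCommGroup E] [NormedSpace ℂ E] [CompleteSpace E]
  [NormedAddCommGroup F] [NormedSpace ℂ F]

theorem hasSum_exp_apply (T : E →L[ℂ] E) (B : E) :
    HasSum (fun k : ℕ => (k.factorial : ℂ)⁻¹ • (T ^ k) B) (NormedSpace.exp T B) :=
  (NormedSpace.exp_series_hasSum_exp' (𝕂 := ℂ) T).mapL (ContinuousLinearMap.apply ℂ E B)

theorem hasDerivAt_exp_smul_apply (Φ : E →L[ℂ] F) (T : E →L[ℂ] E) (B : E) (s : ℝ) :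
    HasDerivAt (fun s : ℝ => Φ (NormedSpace.exp (s • T) B))
      (Φ (T (NormedSpace.exp (s • T) B))) s :=
  ((Φ.comp (ContinuousLinearMap.apply ℂ E B)).restrictScalars ℝ).hasFDerivAt.comp_hasDerivAt s
    (hasDerivAt_exp_smul_const' (𝕂 := ℝ) T s)

end ExpSeries

end Prethermal

namespace Lattice.ExtOp

open Prethermal Finset

variable {d L q : ℕ}

section Flow

/-- The derivation `B ↦ i [G, B]` of extensive local operators. -/
def adI (G : ExtOp d L q) : ExtOp d L q →L[ℂ] ExtOp d L q :=
  LinearMap.toContinuousLinearMap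
    { toFun := fun B => Complex.I • ⁅G, B⁆
      map_add' := fun A B => ext fun S => by
        simp only [term_smul, term_add, term_lie, lie_add, sum_add_distrib, smul_add]
      map_smul' := fun c B => ext fun S => by
        simp only [term_smul, term_lie, Ring.lie_def, mul_smul_comm, smul_mul_assoc, ← smul_sub,
          ← smul_sum, RingHom.id_apply, smul_comm c] }

theorem adI_apply (G B : ExtOp d L q) : adI G B = Complex.I • ⁅G, B⁆ := rfl

theorem op_adI (G B : ExtOp d L q) : (adI G B).op = Complex.I • ⁅G.op, B.op⁆ := by
  rw [adI_apply, op_smul, op_lie]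

/-- `e^{i [G, ·]}`, the conjugation by `e^{iG}` at the level of the local terms. -/
def flow (G : ExtOp d L q) : ExtOp d L q →L[ℂ] ExtOp d L q := NormedSpace.exp (adI G)

theorem hasSum_flow (G B : ExtOp d L q) :
    HasSum (fun k : ℕ => (k.factorial : ℂ)⁻¹ • (adI G ^ k) B) (flow G B) :=
  hasSum_exp_apply (adI G) B

/-- Evolving `e^{is [G, ·]} B` backwards by `G` gives an operator that does not depend on `s`. -/
theorem op_flow (G B : ExtOp d L q) : (flow G B).op = heisenberg G.op 1 B.op := by
  set B' : ℝ → Op d L q := fun s => (NormedSpace.exp (s • adI G) B).op with hB'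
  have hderiv (s : ℝ) : HasDerivAt (fun s => heisenberg (-G.op) s (B' s)) 0 s := by
    have hB' := hasDerivAt_exp_smul_apply opL (adI G) B s
    refine (hasDerivAt_heisenberg_apply _ hB').congr_deriv ?_
    change heisenberg (-G.op) s (Complex.I • ⁅-G.op, B' s⁆ + (adI G _).op) = 0
    rw [op_adI, neg_lie, smul_neg, neg_add_cancel, map_zero]
  have hconst := is_const_of_deriv_eq_zero (fun s => (hderiv s).differentiableAt)
    (fun s => (hderiv s).deriv) 1 0
  have hzero : B' 0 = B.op := by simp [hB']
  have hone : B' 1 = (flow G B).op := by simp [hB', flow]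
  rwa [heisenberg_zero_time, hzero, hone, heisenberg_neg, heisenberg_neg_time,
    AlgEquiv.symm_apply_eq] at hconst

theorem SelfAdj.adI_pow {G B : ExtOp d L q} (hG : G.SelfAdj) (hB : B.SelfAdj) (k : ℕ) :
    ((ExtOp.adI G ^ k) B).SelfAdj := by
  induction k with
  | zero => exact hB
  | succ k ih =>
    rw [pow_succ']
    exact hG.I_smul_lie ih

theorem SelfAdj.flow {G B : ExtOp d L q} (hG : G.SelfAdj) (hB : B.SelfAdj) :
    (flow G B).SelfAdj := by
  refine isClosed_selfAdj.mem_of_tendsto (hasSum_flow G B) (.of_forall fun s => ?_)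
  exact sum_induction _ SelfAdj (fun _ _ => SelfAdj.add) SelfAdj.zero fun k _ =>
    (hG.adI_pow hB k).smul (by simp [isSelfAdjoint_iff])

theorem norm_adI_le {ν η : ℝ} (hη : 0 < η) (hν : η ≤ ν) (G B : ExtOp d L q) :
    (adI G B).norm (ν - η) ≤ 4 / (Real.exp 1 * η) * G.norm ν * B.norm ν := by
  refine (ExtOp.norm_smul_le _ _ _).trans ?_
  simpa using ExtOp.norm_lie_le hη hν G B

variable {μ δ a : ℝ} {G : ExtOp d L q}

theorem norm_adI_pow_le {η : ℝ} (hη : 0 < η) (hG : G.norm μ ≤ a) (B : ExtOp d L q) {k : ℕ}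
    (hk : k * η ≤ μ) :
    ((adI G ^ k) B).norm (μ - k * η) ≤ (4 * a / (Real.exp 1 * η)) ^ k * B.norm μ := by
  induction k with
  | zero => simp
  | succ k ih =>
    rw [Nat.cast_succ] at hk ⊢
    have ha : 0 ≤ a := (norm_nonneg _ _).trans hG
    have hGk : G.norm (μ - k * η) ≤ a := (norm_mono (sub_le_self _ (by positivity)) G).trans hG
    rw [pow_succ' (adI G), show μ - (k + 1) * η = μ - k * η - η by ring]
    calc (adI G ((adI G ^ k) B)).norm (μ - k * η - η)
        ≤ 4 / (Real.exp 1 * η) * G.norm (μ - k * η) * ((adI G ^ k) B).norm (μ - k * η) :=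
          norm_adI_le hη (by linarith) G _
      _ ≤ 4 / (Real.exp 1 * η) * a * ((4 * a / (Real.exp 1 * η)) ^ k * B.norm μ) := by
          gcongr
          · exact norm_nonneg _ _
          · exact ih (by linarith)
      _ = _ := by ring

/-- The loss `δ` is divided equally among the `k` commutators; `k^k ≤ e^k k!` then absorbs the
combinatorial factor. -/
theorem norm_flow_term_le (hδ : 0 < δ) (hμ : δ ≤ μ) (hG : G.norm μ ≤ a) (B : ExtOp d L q) (k : ℕ) :
    ((k.factorial : ℂ)⁻¹ • (adI G ^ k) B).norm (μ - δ) ≤ (4 * a / δ) ^ k * B.norm μ := by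
  obtain rfl | hk := k.eq_zero_or_pos
  · simpa using norm_mono (sub_le_self μ hδ.le) B
  have ha : 0 ≤ a := (norm_nonneg _ _).trans hG
  have hB := norm_nonneg μ B
  have hk' : (0 : ℝ) < k := by exact_mod_cast hk
  have hpow := norm_adI_pow_le (η := δ / k) (by positivity) hG B (k := k)
    (by rwa [mul_div_cancel₀ _ hk'.ne'])
  rw [mul_div_cancel₀ _ hk'.ne'] at hpow
  have hstirling : (k : ℝ) ^ k / k.factorial ≤ Real.exp 1 ^ k := by
    rw [← Real.exp_nat_mul, mul_one]
    exact Real.pow_div_factorial_le_exp (k : ℝ) hk'.le k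
  calc ((k.factorial : ℂ)⁻¹ • (adI G ^ k) B).norm (μ - δ)
      ≤ (k.factorial : ℝ)⁻¹ * ((4 * a / (Real.exp 1 * (δ / k))) ^ k * B.norm μ) := by
        refine (ExtOp.norm_smul_le _ _ _).trans ?_
        rw [norm_inv, Complex.norm_natCast]
        gcongr
    _ = (4 * a / δ) ^ k * ((k : ℝ) ^ k / k.factorial / Real.exp 1 ^ k) * B.norm μ := by
        rw [show 4 * a / (Real.exp 1 * (δ / k)) = 4 * a / δ * (k / Real.exp 1) by field_simp,
          mul_pow, div_pow (k : ℝ)]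
        field_simp
    _ ≤ (4 * a / δ) ^ k * 1 * B.norm μ := by
        gcongr
        exact div_le_one_of_le₀ hstirling (by positivity)
    _ = _ := by rw [mul_one]

theorem norm_flow_le (hδ : 0 < δ) (hμ : δ ≤ μ) (hG : G.norm μ ≤ a) (ha : 4 * a / δ < 1)
    (B : ExtOp d L q) : (flow G B).norm (μ - δ) ≤ (1 - 4 * a / δ)⁻¹ * B.norm μ := by
  have ha₀ : 0 ≤ a := (norm_nonneg _ _).trans hG
  exact norm_le_of_hasSum (hasSum_flow G B)
    ((hasSum_geometric_of_lt_one (by positivity) ha).mul_right _) (norm_flow_term_le hδ hμ hG B)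

theorem hasSum_flow_sub (G B : ExtOp d L q) :
    HasSum (fun k : ℕ => ((k + 1).factorial : ℂ)⁻¹ • (adI G ^ (k + 1)) B) (flow G B - B) := by
  simpa using (hasSum_nat_add_iff' 1).2 (hasSum_flow G B)

theorem norm_flow_sub_le (hδ : 0 < δ) (hμ : δ ≤ μ) (hG : G.norm μ ≤ a) (ha : 4 * a / δ < 1)
    (B : ExtOp d L q) :
    (flow G B - B).norm (μ - δ) ≤ 4 * a / δ * (1 - 4 * a / δ)⁻¹ * B.norm μ := by
  have ha₀ : 0 ≤ a := (norm_nonneg _ _).trans hG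
  refine norm_le_of_hasSum (hasSum_flow_sub G B)
    (((hasSum_geometric_of_lt_one (by positivity) ha).mul_left (4 * a / δ)).mul_right _)
    fun k => ?_
  rw [← pow_succ']
  exact norm_flow_term_le hδ hμ hG B (k + 1)

theorem norm_flow_sub_sub_le (hδ : 0 < δ) (hμ : δ ≤ μ) (hG : G.norm μ ≤ a) (ha : 4 * a / δ < 1)
    (B : ExtOp d L q) :
    (flow G B - B - adI G B).norm (μ - δ) ≤
      4 * a / δ * (1 - 4 * a / δ)⁻¹ * (adI G B).norm μ := by
  have ha₀ : 0 ≤ a := (norm_nonneg _ _).trans hG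
  have hsum : HasSum (fun k : ℕ => ((k + 2).factorial : ℂ)⁻¹ • (adI G ^ (k + 2)) B)
      (flow G B - B - adI G B) := by
    simpa [add_assoc] using (hasSum_nat_add_iff' 1).2 (hasSum_flow_sub G B)
  refine norm_le_of_hasSum hsum
    (((hasSum_geometric_of_lt_one (by positivity) ha).mul_left (4 * a / δ)).mul_right _)
    fun k => ?_
  have hterm : ((k + 2).factorial : ℂ)⁻¹ • (adI G ^ (k + 2)) B =
      ((k + 2 : ℕ) : ℂ)⁻¹ • ((k + 1).factorial : ℂ)⁻¹ • (adI G ^ (k + 1)) (adI G B) := by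
    rw [smul_smul, ← mul_inv, ← Nat.cast_mul, ← Nat.factorial_succ, pow_succ]
    rfl
  rw [hterm, ← pow_succ']
  refine (ExtOp.norm_smul_le _ _ _).trans ((mul_le_of_le_one_left (norm_nonneg _ _) ?_).trans
    (norm_flow_term_le hδ hμ hG (adI G B) (k + 1)))
  rw [norm_inv, Complex.norm_natCast]
  exact Nat.cast_inv_le_one _

end Flow

end Lattice.ExtOp

namespace Prethermal

section Average

open Complex intervalIntegral

variable {𝔸 : Type*} [CStarAlgebra 𝔸]

theorem propagator_two_pi {N : 𝔸} (hN : IsSelfAdjoint N)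
    (hint : ∀ z ∈ spectrum ℂ N, ∃ n : ℤ, z = n) : propagator N (2 * Real.pi) = 1 := by
  have := hN.isStarNormal
  ext
  rw [coe_propagator, Units.val_one]
  rw [← CFC.complex_exp_eq_normedSpace_exp (p := IsStarNormal), ← cfc_comp_smul _ _ N,
    cfc_congr (g := fun _ => 1), cfc_const_one ℂ N]
  intro z hz
  obtain ⟨n, rfl⟩ := hint z hz
  change exp (I * (2 * Real.pi : ℝ) * n) = 1
  rw [← exp_int_mul_two_pi_mul_I n]
  push_cast
  ring_nf

theorem heisenberg_two_pi {N : 𝔸} (hN : IsSelfAdjoint N)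
    (hint : ∀ z ∈ spectrum ℂ N, ∃ n : ℤ, z = n) (A : 𝔸) : heisenberg N (2 * Real.pi) A = A := by
  rw [heisenberg_apply, propagator_two_pi hN hint, inv_one, Units.val_one, one_mul, mul_one]

/-- The mean of the evolution of `A` under `N` over one period `2π`, with weight `w`. The weight `1`
projects `A` to the commutant of `N`; the weight `s - π` inverts the derivation `i [N, ·]`. -/
def flowAverage (w : C(ℝ, ℝ)) (N A : 𝔸) : 𝔸 :=
  (2 * Real.pi)⁻¹ • ∫ s in (0 : ℝ)..(2 * Real.pi), w s • heisenberg N s A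

/-- The weight of the average solving the cohomological equation `i [N, G] = A - ⟨A⟩`. -/
def sawtooth : C(ℝ, ℝ) := .id ℝ - .const ℝ Real.pi

theorem continuous_smul_heisenberg (w : C(ℝ, ℝ)) (N A : 𝔸) :
    Continuous fun s => w s • heisenberg N s A :=
  w.continuous.smul (continuous_heisenberg N A)

theorem map_flowAverage (T : 𝔸 →L[ℝ] 𝔸) (w : C(ℝ, ℝ)) (N A : 𝔸) :
    T (flowAverage w N A) =
      (2 * Real.pi)⁻¹ • ∫ s in (0 : ℝ)..(2 * Real.pi), w s • T (heisenberg N s A) := by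
  simp only [flowAverage, map_smul,
    ← T.intervalIntegral_comp_comm ((continuous_smul_heisenberg w N A).intervalIntegrable _ _)]

@[simp] theorem flowAverage_zero (w : C(ℝ, ℝ)) (N : 𝔸) : flowAverage w N 0 = 0 := by
  simp [flowAverage]

/-- The derivation `X ↦ [N, X]` as a continuous linear map. -/
def lieL (N : 𝔸) : 𝔸 →L[ℝ] 𝔸 :=
  ContinuousLinearMap.mul ℝ 𝔸 N - (ContinuousLinearMap.mul ℝ 𝔸).flip N

theorem lieL_apply (N X : 𝔸) : lieL N X = ⁅N, X⁆ := rfl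

theorem commute_flowAverage {N A E : 𝔸} (w : C(ℝ, ℝ))
    (h : ∀ s, Commute (heisenberg N s A) E) : Commute (flowAverage w N A) E := by
  refine .symm ?_
  rw [commute_iff_lie_eq, ← lieL_apply, map_flowAverage]
  simp [lieL_apply, (h _).symm.lie_eq]

theorem lie_flowAverage (w : C(ℝ, ℝ)) (N A : 𝔸) :
    ⁅N, flowAverage w N A⁆ = flowAverage w N ⁅N, A⁆ := by
  rw [← lieL_apply, map_flowAverage]
  simp only [lieL_apply, flowAverage, heisenberg_lie_self]

theorem isSelfAdjoint_flowAverage {N A : 𝔸} (hN : IsSelfAdjoint N) (hA : IsSelfAdjoint A)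
    (w : C(ℝ, ℝ)) : IsSelfAdjoint (flowAverage w N A) := by
  have h := map_flowAverage (starL' ℝ : 𝔸 ≃L[ℝ] 𝔸).toContinuousLinearMap w N A
  simp only [ContinuousLinearEquiv.coe_coe, starL'_apply, ← star_heisenberg hN, hA.star_eq] at h
  exact h

theorem norm_flowAverage_le {N : 𝔸} (hN : IsSelfAdjoint N) {w : C(ℝ, ℝ)} {c : ℝ}
    (hw : ∀ s ∈ Set.Ioc 0 (2 * Real.pi), |w s| ≤ c) (A : 𝔸) :
    ‖flowAverage w N A‖ ≤ c * ‖A‖ := by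
  have hbound := norm_integral_le_of_norm_le_const (a := 0) (b := 2 * Real.pi) (C := c * ‖A‖)
    (f := fun s => w s • heisenberg N s A) fun s hs => by
      rw [Set.uIoc_of_le (by positivity)] at hs
      rw [norm_smul, norm_heisenberg hN, Real.norm_eq_abs]
      gcongr
      exact hw s hs
  rw [sub_zero, abs_of_nonneg (by positivity)] at hbound
  rw [flowAverage, norm_smul, Real.norm_of_nonneg (by positivity), inv_mul_le_iff₀ (by positivity)]
  linarith

theorem abs_sawtooth_le {s : ℝ} (hs : s ∈ Set.Ioc 0 (2 * Real.pi)) : |sawtooth s| ≤ Real.pi :=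
  abs_le.2 ⟨by simpa [sawtooth] using hs.1.le, by simpa [sawtooth, two_mul] using hs.2⟩

/-- Integrating the derivative of the evolution over a period gives zero. -/
theorem commute_flowAverage_one {N A : 𝔸} (hper : heisenberg N (2 * Real.pi) A = A) :
    Commute N (flowAverage 1 N A) := by
  have h := integral_eq_sub_of_hasDerivAt (a := 0) (b := 2 * Real.pi)
    (fun s _ => hasDerivAt_heisenberg' N A s)
    ((((lieL N).continuous.comp (continuous_heisenberg N A)).const_smul I).intervalIntegrable _ _)
  rw [hper, heisenberg_zero_time, sub_self, integral_smul, smul_eq_zero_iff_right I_ne_zero] at h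
  rw [commute_iff_lie_eq, ← lieL_apply, map_flowAverage]
  simp [lieL_apply, h]

/-- Integration by parts: the boundary term of the weight `s - π` over a period is `2π A`. -/
theorem I_smul_lie_flowAverage_sawtooth {N A : 𝔸} (hper : heisenberg N (2 * Real.pi) A = A) :
    I • ⁅N, flowAverage sawtooth N A⁆ = A - flowAverage 1 N A := by
  have hderiv (s : ℝ) : HasDerivAt (fun s => sawtooth s • heisenberg N s A)
      (sawtooth s • I • ⁅N, heisenberg N s A⁆ + (1 : ℝ) • heisenberg N s A) s :=
    ((hasDerivAt_id s).sub_const Real.pi).smul (hasDerivAt_heisenberg' N A s)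
  have hcont : Continuous fun s => sawtooth s • I • ⁅N, heisenberg N s A⁆ :=
    sawtooth.continuous.smul (((lieL N).continuous.comp (continuous_heisenberg N A)).const_smul I)
  have hcont' : Continuous fun s => (1 : ℝ) • heisenberg N s A :=
    (continuous_heisenberg N A).const_smul 1
  have h := integral_eq_sub_of_hasDerivAt (a := 0) (b := 2 * Real.pi) (fun s _ => hderiv s)
    ((hcont.add hcont').intervalIntegrable _ _)
  have hperiod : sawtooth (2 * Real.pi) - sawtooth 0 = 2 * Real.pi := by
    change 2 * Real.pi - Real.pi - (0 - Real.pi) = _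
    ring
  rw [integral_add (hcont.intervalIntegrable _ _) (hcont'.intervalIntegrable _ _), hper,
    heisenberg_zero_time, ← sub_smul, hperiod] at h
  simp only [smul_comm _ I, integral_smul] at h
  rw [← lieL_apply, map_flowAverage, smul_comm]
  simp only [lieL_apply, eq_sub_of_add_eq h]
  rw [smul_sub, inv_smul_smul₀ (by positivity), flowAverage]
  simp

/-- The commutator `[N, A]` has mean zero, so the cohomological equation recovers it. -/
theorem I_smul_lie_flowAverage_lie {N A : 𝔸} (hper : heisenberg N (2 * Real.pi) A = A) :
    I • ⁅N, flowAverage sawtooth N ⁅N, A⁆⁆ = ⁅N, A⁆ := by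
  have hper' : heisenberg N (2 * Real.pi) ⁅N, A⁆ = ⁅N, A⁆ := by rw [heisenberg_lie_self, hper]
  rw [I_smul_lie_flowAverage_sawtooth hper', ← lie_flowAverage,
    (commute_flowAverage_one hper).lie_eq, sub_zero]

end Average

end Prethermal

namespace Lattice.ExtOp

open Prethermal Finset

variable {d L q : ℕ}

section Average

/-- The terms of `N` inside `S` and those inside the complement commute, and the latter do not act
on `S`. -/
theorem OnSite.supportedOn_heisenberg {N : ExtOp d L q} (hN : N.OnSite) {S : Finset (Site d L)}
    {A : Op d L q} (hA : SupportedOn S A) (t : ℝ) : SupportedOn S (heisenberg N.op t A) := by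
  have hsplit : N.op = (∑ T : Finset (Site d L) with T ⊆ S, N.term T) +
      ∑ T : Finset (Site d L) with ¬ T ⊆ S, N.term T :=
    (sum_filter_add_sum_filter_not _ _ _).symm
  have hin : SupportedOn S (∑ T : Finset (Site d L) with T ⊆ S, N.term T) :=
    mem_localAlgebra.1 <| sum_mem fun T hT =>
      mem_localAlgebra.2 ((N.supported T).mono (mem_filter.1 hT).2)
  have hout : SupportedOn Sᶜ (∑ T : Finset (Site d L) with ¬ T ⊆ S, N.term T) := by
    refine mem_localAlgebra.1 (sum_mem fun T hT => mem_localAlgebra.2 ?_)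
    by_cases hcard : T.card = 1
    · obtain ⟨x, rfl⟩ := card_eq_one.1 hcard
      exact (N.supported {x}).mono (by simpa using hT)
    · rw [hN T hcard]
      exact supportedOn_zero _
  rw [hsplit, heisenberg_add_of_commute (hin.commute hout disjoint_compl_right)
    (hout.commute hA disjoint_compl_left)]
  exact hin.heisenberg hA t

theorem OnSite.supportedOn_flowAverage {N : ExtOp d L q} (hN : N.OnSite) {S : Finset (Site d L)}
    {A : Op d L q} (hA : SupportedOn S A) (w : C(ℝ, ℝ)) :
    SupportedOn S (Prethermal.flowAverage w N.op A) :=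
  supportedOn_iff_commute_siteUnit.2 fun _ hx i j => commute_flowAverage w fun s =>
    supportedOn_iff_commute_siteUnit.1 (hN.supportedOn_heisenberg hA s) _ hx i j

/-- The weighted average under the flow of `N`, applied to each local term. As `N` acts on-site, no
support grows. -/
def OnSite.flowAverage {N : ExtOp d L q} (hN : N.OnSite) (w : C(ℝ, ℝ)) (V : ExtOp d L q) :
    ExtOp d L q where
  term S := Prethermal.flowAverage w N.op (V.term S)
  supported S := hN.supportedOn_flowAverage (V.supported S) w
  term_eq_zero S hS := by rw [V.term_eq_zero S hS, flowAverage_zero]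

variable {N V : ExtOp d L q}

theorem OnSite.selfAdj_flowAverage (hN : N.OnSite) (hsa : N.SelfAdj) (hV : V.SelfAdj)
    (w : C(ℝ, ℝ)) : (hN.flowAverage w V).SelfAdj :=
  fun S => isSelfAdjoint_flowAverage hsa.op (hV S) w

theorem OnSite.norm_flowAverage_le (hN : N.OnSite) (hsa : N.SelfAdj) {w : C(ℝ, ℝ)} {c : ℝ}
    (hw : ∀ s ∈ Set.Ioc 0 (2 * Real.pi), |w s| ≤ c) (hc : 0 ≤ c) (μ : ℝ) :
    (hN.flowAverage w V).norm μ ≤ c * V.norm μ :=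
  norm_le_mul_norm hc fun S => by
    rw [← mul_assoc]
    gcongr
    exact Prethermal.norm_flowAverage_le hsa.op hw (V.term S)

theorem OnSite.norm_flowAverage_one_le (hN : N.OnSite) (hsa : N.SelfAdj) (μ : ℝ) :
    (hN.flowAverage 1 V).norm μ ≤ V.norm μ := by
  simpa using hN.norm_flowAverage_le (V := V) (w := 1) hsa (c := 1) (by simp) zero_le_one μ

theorem OnSite.norm_flowAverage_sawtooth_le (hN : N.OnSite) (hsa : N.SelfAdj) (μ : ℝ) :
    (hN.flowAverage sawtooth V).norm μ ≤ Real.pi * V.norm μ :=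
  hN.norm_flowAverage_le hsa (fun _ => abs_sawtooth_le) Real.pi_pos.le μ

theorem OnSite.commute_op_flowAverage_one (hN : N.OnSite)
    (hper : ∀ A, heisenberg N.op (2 * Real.pi) A = A) :
    Commute N.op (hN.flowAverage 1 V).op :=
  Commute.sum_right _ _ _ fun _ _ => commute_flowAverage_one (hper _)

theorem OnSite.adI_flowAverage_sawtooth (hN : N.OnSite)
    (hper : ∀ A, heisenberg N.op (2 * Real.pi) A = A) :
    adI (hN.flowAverage sawtooth V) N = hN.flowAverage 1 V - V := by
  refine ext fun S => ?_
  rw [adI_apply, term_smul, hN.term_lie, ← lie_skew, smul_neg]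
  exact (congrArg Neg.neg (I_smul_lie_flowAverage_sawtooth (hper (V.term S)))).trans (neg_sub _ _)

end Average

end Lattice.ExtOp

namespace Prethermal

section NormalForm

open Lattice.ExtOp

variable {d L q : ℕ}

/-- A normal form of the Hamiltonian `H` after `k` steps of the iteration: a ⋆-automorphism `conj`
maps `N + Z + V` to `H`, where `Z` commutes with `N` and `V` is exponentially small in `k`. The map
`back` realises `conj` on local terms. Each step costs `δ` in the weight of the local norm, and
`8 / 7 * (1 - (1 / 8) ^ k)` is the sum of the first `k` powers of `1 / 8`. -/
structure NormalForm (N : ExtOp d L q) (H : Op d L q) (κ δ p : ℝ) (k : ℕ) where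
  Z : ExtOp d L q
  V : ExtOp d L q
  back : ExtOp d L q → ExtOp d L q
  conj : Op d L q ≃⋆ₐ[ℂ] Op d L q
  selfAdj_Z : Z.SelfAdj
  selfAdj_V : V.SelfAdj
  selfAdj_back : ∀ B : ExtOp d L q, B.SelfAdj → (back B).SelfAdj
  op_back : ∀ B, (back B).op = conj B.op
  conj_op : conj (N + Z + V).op = H
  commute_Z : Commute N.op Z.op
  norm_Z_le : Z.norm (κ - k * δ) ≤ p * (8 / 7 * (1 - (1 / 8) ^ k))
  norm_V_le : V.norm (κ - k * δ) ≤ p * (1 / 8) ^ k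
  norm_back_le : ∀ ν, k * δ ≤ ν → ν ≤ 3 * κ / 4 → ∀ B,
    (back B).norm (ν - k * δ) ≤ (2 - (1 / 2) ^ k) * B.norm ν
  norm_conj_sub_le : ‖conj N.op - N.op‖ ≤ Fintype.card (Site d L) *
    (8 / 7 * (1 - (1 / 8) ^ k) *
      (2 * (Real.exp (-(3 * κ / 4)) * (Real.pi * p)) * (Real.exp (-κ) * N.norm κ)))

namespace NormalForm

/-- The trivial normal form, with which the iteration starts. -/
def zero (N : ExtOp d L q) {P : ExtOp d L q} (hP : P.SelfAdj) {κ δ p : ℝ} (hp : P.norm κ ≤ p) :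
    NormalForm N (N.op + P.op) κ δ p 0 where
  Z := 0
  V := P
  back := id
  conj := .refl ℂ (Op d L q)
  selfAdj_Z := .zero
  selfAdj_V := hP
  selfAdj_back _ := id
  op_back _ := rfl
  conj_op := by simp
  commute_Z := by simp
  norm_Z_le := by simp
  norm_V_le := by simpa using hp
  norm_back_le ν _ _ B := by norm_num
  norm_conj_sub_le := by simp

variable {N : ExtOp d L q} {H : Op d L q} {κ δ p : ℝ} {k : ℕ}

section Step

variable (F : NormalForm N H κ δ p k) (hN : N.OnSite)

/-- The generator of the rotation that removes `V - ⟨V⟩` to first order. -/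
def generator : ExtOp d L q := hN.flowAverage sawtooth F.V

/-- The part commuting with `N` after one more step. -/
def nextZ : ExtOp d L q := F.Z + hN.flowAverage 1 F.V

/-- What the rotation leaves of `N + Z + V` besides `N` and the part commuting with `N`. -/
def nextV : ExtOp d L q := flow (F.generator hN) (N + F.Z + F.V) - N - F.nextZ hN

theorem selfAdj_generator (hsa : N.SelfAdj) : (F.generator hN).SelfAdj :=
  hN.selfAdj_flowAverage hsa F.selfAdj_V _

theorem selfAdj_nextZ (hsa : N.SelfAdj) : (F.nextZ hN).SelfAdj :=
  F.selfAdj_Z.add (hN.selfAdj_flowAverage hsa F.selfAdj_V _)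

theorem selfAdj_nextV (hsa : N.SelfAdj) : (F.nextV hN).SelfAdj :=
  (((F.selfAdj_generator hN hsa).flow ((hsa.add F.selfAdj_Z).add F.selfAdj_V)).sub hsa).sub
    (F.selfAdj_nextZ hN hsa)

theorem norm_generator_le (hsa : N.SelfAdj) :
    (F.generator hN).norm (κ - k * δ) ≤ Real.pi * (p * (1 / 8) ^ k) :=
  (hN.norm_flowAverage_sawtooth_le hsa _).trans
    (mul_le_mul_of_nonneg_left F.norm_V_le Real.pi_pos.le)

theorem norm_nextZ_le (hsa : N.SelfAdj) :
    (F.nextZ hN).norm (κ - k * δ) ≤ p * (8 / 7 * (1 - (1 / 8) ^ (k + 1))) :=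
  calc _ ≤ p * (8 / 7 * (1 - (1 / 8) ^ k)) + p * (1 / 8) ^ k :=
        (ExtOp.norm_add_le _ _ _).trans
          (add_le_add F.norm_Z_le ((hN.norm_flowAverage_one_le hsa _).trans F.norm_V_le))
    _ = _ := by rw [pow_succ]; ring

/-- The cohomological equation cancels the terms of first order. -/
theorem nextV_eq (hper : ∀ A, heisenberg N.op (2 * Real.pi) A = A) :
    F.nextV hN = (flow (F.generator hN) (F.Z + F.V) - (F.Z + F.V)) +
      (flow (F.generator hN) N - N - adI (F.generator hN) N) := by
  rw [nextV, nextZ, generator, hN.adI_flowAverage_sawtooth hper, add_assoc N, map_add]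
  abel

theorem four_mul_div_le (hsmall : 4 * Real.pi * p / δ ≤ 1 / 25) (k : ℕ) :
    4 * (Real.pi * (p * (1 / 8) ^ k)) / δ ≤ (1 / 8) ^ k / 25 :=
  calc _ = (1 / 8) ^ k * (4 * Real.pi * p / δ) := by ring
    _ ≤ (1 / 8) ^ k * (1 / 25) := by gcongr
    _ = _ := by ring

theorem pow_eighth_le_one (k : ℕ) : (1 / 8 : ℝ) ^ k ≤ 1 := pow_le_one₀ (by norm_num) (by norm_num)

theorem norm_nextV_le (hsa : N.SelfAdj) (hper : ∀ A, heisenberg N.op (2 * Real.pi) A = A)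
    (hδ : 0 < δ) (hp : 0 ≤ p) (hk : (k + 1) * δ ≤ κ) (hsmall : 4 * Real.pi * p / δ ≤ 1 / 25) :
    (F.nextV hN).norm (κ - k * δ - δ) ≤ p * (1 / 8) ^ (k + 1) := by
  set r : ℝ := (1 / 8) ^ k with hr
  set θ : ℝ := 4 * (Real.pi * (p * r)) / δ
  set μ : ℝ := κ - k * δ
  have hr₀ : 0 < r := by positivity
  have hr₁ : r ≤ 1 := pow_eighth_le_one k
  have hθr : θ ≤ r / 25 := four_mul_div_le hsmall k
  have hδμ : δ ≤ μ := by linarith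
  have hG : (F.generator hN).norm μ ≤ Real.pi * (p * r) := F.norm_generator_le hN hsa
  have hZV : (F.Z + F.V).norm μ ≤ p * (8 / 7 * (1 - r)) + p * r :=
    (ExtOp.norm_add_le _ _ _).trans (add_le_add F.norm_Z_le F.norm_V_le)
  have hmean : (hN.flowAverage 1 F.V - F.V).norm μ ≤ 2 * (p * r) := by
    have hY := hN.norm_flowAverage_one_le (V := F.V) hsa μ
    have hV : F.V.norm μ ≤ p * r := F.norm_V_le
    linarith [ExtOp.norm_sub_le μ (hN.flowAverage 1 F.V) F.V]
  have hsum : (F.Z + F.V).norm μ + (hN.flowAverage 1 F.V - F.V).norm μ ≤ 3 * p := by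
    nlinarith [mul_nonneg hp hr₀.le, mul_nonneg hp (sub_nonneg.2 hr₁)]
  have hinv : (1 - θ)⁻¹ ≤ 25 / 24 := by
    rw [inv_le_comm₀ (by linarith) (by norm_num)]
    linarith
  have hinv₀ : 0 ≤ (1 - θ)⁻¹ := inv_nonneg.2 (by linarith)
  have hnonneg := add_nonneg (ExtOp.norm_nonneg μ (F.Z + F.V))
    (ExtOp.norm_nonneg μ (hN.flowAverage 1 F.V - F.V))
  rw [F.nextV_eq hN hper]
  calc _ ≤ θ * (1 - θ)⁻¹ * (F.Z + F.V).norm μ +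
          θ * (1 - θ)⁻¹ * (hN.flowAverage 1 F.V - F.V).norm μ := by
        rw [← hN.adI_flowAverage_sawtooth hper]
        exact (ExtOp.norm_add_le _ _ _).trans (add_le_add
          (norm_flow_sub_le hδ hδμ hG (by linarith) _)
          (norm_flow_sub_sub_le hδ hδμ hG (by linarith) N))
    _ = θ * (1 - θ)⁻¹ * ((F.Z + F.V).norm μ + (hN.flowAverage 1 F.V - F.V).norm μ) := by ring
    _ ≤ r / 25 * (25 / 24) * (3 * p) := by gcongr
    _ = p * (1 / 8) ^ (k + 1) := by rw [pow_succ, ← hr]; ring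

theorem norm_generator_le_of_le (hsa : N.SelfAdj) {ν : ℝ} (hν : ν ≤ κ - k * δ) :
    (F.generator hN).norm ν ≤ Real.pi * (p * (1 / 8) ^ k) :=
  (norm_mono hν _).trans (F.norm_generator_le hN hsa)

/-- Undoing the rotation costs a factor `1 / (1 - θ)` with `θ ≤ 8⁻ᵏ / 25`. -/
theorem norm_back_flow_le (hsa : N.SelfAdj) (hδ : 0 < δ) (hp : 0 ≤ p)
    (hk : (k + 1) * δ ≤ κ / 4) (hsmall : 4 * Real.pi * p / δ ≤ 1 / 25) {ν : ℝ}
    (hν : (k + 1) * δ ≤ ν) (hνκ : ν ≤ 3 * κ / 4) (B : ExtOp d L q) :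
    (F.back (flow (-F.generator hN) B)).norm (ν - (k + 1) * δ) ≤
      (2 - (1 / 2) ^ (k + 1)) * B.norm ν := by
  set c : ℝ := (1 / 2) ^ k with hc
  set θ : ℝ := 4 * (Real.pi * (p * (1 / 8) ^ k)) / δ
  have hc₀ : 0 < c := by positivity
  have hc₁ : c ≤ 1 := pow_le_one₀ (by norm_num) (by norm_num)
  have hθ₀ : 0 ≤ θ := by positivity
  have hθc : θ ≤ c / 25 := (four_mul_div_le hsmall k).trans (by
    gcongr
    exact pow_le_pow_left₀ (by norm_num) (by norm_num) k)
  have hkδ : 0 ≤ k * δ := by positivity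
  have hG : (-F.generator hN).norm ν ≤ Real.pi * (p * (1 / 8) ^ k) := by
    rw [ExtOp.norm_neg]
    exact F.norm_generator_le_of_le hN hsa (by linarith)
  have hfactor : (2 - c) * (1 - θ)⁻¹ ≤ 2 - c / 2 := by
    rw [← div_eq_mul_inv, div_le_iff₀ (by linarith)]
    nlinarith
  have hc₂ : 0 ≤ 2 - c := by linarith
  rw [show ν - (k + 1) * δ = ν - δ - k * δ by ring]
  calc _ ≤ (2 - c) * (flow (-F.generator hN) B).norm (ν - δ) :=
        F.norm_back_le (ν - δ) (by linarith) (by linarith) _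
    _ ≤ (2 - c) * ((1 - θ)⁻¹ * B.norm ν) := by
        gcongr
        exact norm_flow_le hδ (by linarith) hG (by linarith) B
    _ = (2 - c) * (1 - θ)⁻¹ * B.norm ν := (mul_assoc _ _ _).symm
    _ ≤ (2 - c / 2) * B.norm ν := mul_le_mul_of_nonneg_right hfactor (ExtOp.norm_nonneg _ _)
    _ = _ := by rw [pow_succ, ← hc]; ring

theorem norm_heisenberg_generator_sub_le (hsa : N.SelfAdj) (hκ : 0 ≤ κ) (hk : k * δ ≤ κ / 4) :
    ‖heisenberg (-(F.generator hN).op) 1 N.op - N.op‖ ≤ Fintype.card (Site d L) *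
      (2 * (Real.exp (-(3 * κ / 4)) * (Real.pi * (p * (1 / 8) ^ k))) *
        (Real.exp (-κ) * N.norm κ)) := by
  have hG : (F.generator hN).norm (3 * κ / 4) ≤ Real.pi * (p * (1 / 8) ^ k) :=
    F.norm_generator_le_of_le hN hsa (by linarith)
  have hN₀ := ExtOp.norm_nonneg κ N
  calc _ ≤ ‖⁅(F.generator hN).op, N.op⁆‖ :=
        (norm_heisenberg_sub_le (F.selfAdj_generator hN hsa).op.neg 1 N.op).trans_eq (by
          rw [abs_one, one_mul, neg_lie, _root_.norm_neg])
    _ ≤ Fintype.card (Site d L) * (2 * (Real.exp (-(3 * κ / 4)) *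
        (F.generator hN).norm (3 * κ / 4)) * (Real.exp (-κ) * N.norm κ)) :=
      norm_lie_op_op_le (by positivity) hκ (F.generator hN) N
    _ ≤ _ := by gcongr

theorem norm_conj_heisenberg_sub_le (hsa : N.SelfAdj) (hκ : 0 ≤ κ)
    (hk : k * δ ≤ κ / 4) :
    ‖F.conj (heisenberg (-(F.generator hN).op) 1 N.op) - N.op‖ ≤ Fintype.card (Site d L) *
      (8 / 7 * (1 - (1 / 8) ^ (k + 1)) *
        (2 * (Real.exp (-(3 * κ / 4)) * (Real.pi * p)) * (Real.exp (-κ) * N.norm κ))) := by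
  calc _ = ‖F.conj (heisenberg (-(F.generator hN).op) 1 N.op - N.op) + (F.conj N.op - N.op)‖ := by
        rw [map_sub, sub_add_sub_cancel]
    _ ≤ ‖heisenberg (-(F.generator hN).op) 1 N.op - N.op‖ + ‖F.conj N.op - N.op‖ :=
        (_root_.norm_add_le _ _).trans_eq (by
          rw [NonUnitalStarAlgHom.norm_map F.conj F.conj.injective])
    _ ≤ _ := add_le_add (F.norm_heisenberg_generator_sub_le hN hsa hκ hk) F.norm_conj_sub_le
    _ = _ := by rw [pow_succ]; ring

/-- One step of the iteration: the rotation generated by the solution of the cohomological equation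
for `V` divides the size of the remainder by eight. -/
def step (hsa : N.SelfAdj) (hper : ∀ A, heisenberg N.op (2 * Real.pi) A = A) (hκ : 0 < κ)
    (hδ : 0 < δ) (hp : 0 ≤ p) (hk : (k + 1) * δ ≤ κ / 4)
    (hsmall : 4 * Real.pi * p / δ ≤ 1 / 25) : NormalForm N H κ δ p (k + 1) where
  Z := F.nextZ hN
  V := F.nextV hN
  back B := F.back (flow (-F.generator hN) B)
  conj := (heisenbergStar (F.selfAdj_generator hN hsa).op.neg 1).trans F.conj
  selfAdj_Z := F.selfAdj_nextZ hN hsa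
  selfAdj_V := F.selfAdj_nextV hN hsa
  selfAdj_back B hB := F.selfAdj_back _ ((F.selfAdj_generator hN hsa).neg.flow hB)
  op_back B := by
    rw [F.op_back, op_flow, op_neg]
    rfl
  conj_op := by
    have hrotate : N + F.nextZ hN + F.nextV hN = flow (F.generator hN) (N + F.Z + F.V) := by
      rw [nextV]
      abel
    change F.conj (heisenberg (-(F.generator hN).op) 1 _) = H
    rw [hrotate, op_flow, heisenberg_neg, heisenberg_neg_time, AlgEquiv.symm_apply_apply,
      F.conj_op]
  commute_Z := by
    rw [nextZ, op_add]
    exact F.commute_Z.add_right (hN.commute_op_flowAverage_one hper)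
  norm_Z_le := by
    refine (norm_mono ?_ _).trans (F.norm_nextZ_le hN hsa)
    push_cast
    linarith
  norm_V_le := by
    have h := F.norm_nextV_le hN hsa hper hδ hp (by linarith) hsmall
    rwa [sub_sub, ← add_one_mul, ← Nat.cast_add_one] at h
  norm_back_le ν hν hνκ B := by
    push_cast at hν ⊢
    exact F.norm_back_flow_le hN hsa hδ hp hk hsmall hν hνκ B
  norm_conj_sub_le := F.norm_conj_heisenberg_sub_le hN hsa hκ.le (by linarith)

end Step

theorem nonempty {P : ExtOp d L q} (hN : N.OnSite) (hsa : N.SelfAdj) (hP : P.SelfAdj)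
    (hper : ∀ A, heisenberg N.op (2 * Real.pi) A = A) (hκ : 0 < κ) (hδ : 0 < δ)
    (hp : P.norm κ ≤ p) (hsmall : 4 * Real.pi * p / δ ≤ 1 / 25) (n : ℕ) (hn : n * δ ≤ κ / 4) :
    Nonempty (NormalForm N (N.op + P.op) κ δ p n) := by
  induction n with
  | zero => exact ⟨zero N hP hp⟩
  | succ n ih =>
    push_cast at hn
    obtain ⟨F⟩ := ih (by linarith)
    exact ⟨F.step hN hsa hper hκ hδ ((ExtOp.norm_nonneg _ _).trans hp) hn hsmall⟩

end NormalForm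

end NormalForm

section LiebRobinson

open Finset Lattice.ExtOp

variable {d L q : ℕ} {κ : ℝ} {S : Finset (Site d L)}

/-- The weight `∑_{y ∈ S} exp (-μ |x - y|)` with which Lieb–Robinson bounds decay away from `S`. -/
def decay (μ : ℝ) (S : Finset (Site d L)) (x : Site d L) : ℝ :=
  ∑ y ∈ S, Real.exp (-μ * dist x y)

theorem decay_pos (μ : ℝ) (hS : S.Nonempty) (x : Site d L) : 0 < decay μ S x :=
  sum_pos (fun _ _ => Real.exp_pos _) hS

theorem decay_nonneg (μ : ℝ) (S : Finset (Site d L)) (x : Site d L) : 0 ≤ decay μ S x :=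
  sum_nonneg fun _ _ => (Real.exp_pos _).le

theorem one_le_decay (μ : ℝ) {x : Site d L} (hx : x ∈ S) : 1 ≤ decay μ S x :=
  calc 1 = Real.exp (-μ * dist x x) := by rw [dist_self, mul_zero, Real.exp_zero]
    _ ≤ decay μ S x := single_le_sum (f := fun y => Real.exp (-μ * dist x y))
        (fun _ _ => (Real.exp_pos _).le) hx

theorem sum_decay_nonneg (μ : ℝ) (S Y : Finset (Site d L)) : 0 ≤ ∑ y ∈ Y, decay μ S y :=
  sum_nonneg fun _ _ => decay_nonneg _ _ _

theorem decay_le_sum_decay (μ : ℝ) (S : Finset (Site d L)) {Y : Finset (Site d L)} {y : Site d L}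
    (hy : y ∈ Y) : decay μ S y ≤ ∑ y ∈ Y, decay μ S y :=
  single_le_sum (f := decay μ S) (fun _ _ => decay_nonneg _ _ _) hy

theorem decay_le_of_isConn {μ : ℝ} (hμ : 0 ≤ μ) (S : Finset (Site d L)) {X : Finset (Site d L)}
    (hX : IsConn X) {x y : Site d L} (hx : x ∈ X) (hy : y ∈ X) :
    decay μ S x ≤ Real.exp (μ * X.card) * decay μ S y := by
  rw [decay, decay, mul_sum]
  refine sum_le_sum fun z _ => ?_
  rw [← Real.exp_add, Real.exp_le_exp]
  nlinarith [dist_triangle y x z, hX.dist_le hy hx]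

/-- Half of the weight `κ` pays for moving from `x` to `y`, the other half for the number of
sites. -/
theorem sum_decay_le_of_isConn (hκ : 0 < κ) (S : Finset (Site d L)) {X : Finset (Site d L)}
    (hX : IsConn X) {y : Site d L} (hy : y ∈ X) :
    ∑ x ∈ X, decay (κ / 2) S x ≤ κ⁻¹ * Real.exp (κ * X.card) * decay (κ / 2) S y := by
  have hinv : (Real.exp 1 * (κ / 2))⁻¹ ≤ κ⁻¹ :=
    inv_anti₀ hκ (by nlinarith [Real.add_one_le_exp (1 : ℝ)])
  have hdecay := decay_nonneg (κ / 2) S y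
  calc ∑ x ∈ X, decay (κ / 2) S x
      ≤ X.card • (Real.exp (κ / 2 * X.card) * decay (κ / 2) S y) :=
        sum_le_card_nsmul _ _ _ fun x hx => decay_le_of_isConn (by positivity) S hX hx hy
    _ = X.card * Real.exp ((κ - κ / 2) * X.card) * decay (κ / 2) S y := by
        rw [nsmul_eq_mul, sub_half, mul_assoc]
    _ ≤ (Real.exp 1 * (κ / 2))⁻¹ * Real.exp (κ * X.card) * decay (κ / 2) S y := by
        exact mul_le_mul_of_nonneg_right (natCast_mul_exp_le (half_pos hκ) κ X.card) hdecay
    _ ≤ _ := by gcongr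

theorem sum_norm_term_mul_decay_le (hκ : 0 < κ) (S Y : Finset (Site d L)) (h : ExtOp d L q) :
    ∑ X with ¬ Disjoint Y X, ‖h.term X‖ * ∑ x ∈ X, decay (κ / 2) S x ≤
      h.norm κ / κ * ∑ y ∈ Y, decay (κ / 2) S y := by
  have hsite (y : Site d L) : ∑ X with y ∈ X, ‖h.term X‖ * ∑ x ∈ X, decay (κ / 2) S x ≤
      h.norm κ / κ * decay (κ / 2) S y := by
    have hdecay := decay_nonneg (κ / 2) S y
    calc _ ≤ ∑ X with y ∈ X, ‖h.term X‖ * Real.exp (κ * X.card) * (κ⁻¹ * decay (κ / 2) S y) := by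
          refine sum_le_sum fun X hX => ?_
          by_cases hc : IsConn X
          · calc _ ≤ ‖h.term X‖ * (κ⁻¹ * Real.exp (κ * X.card) * decay (κ / 2) S y) := by
                  gcongr
                  exact sum_decay_le_of_isConn hκ S hc (mem_filter.1 hX).2
              _ = _ := by ring
          · simp [h.term_eq_zero X hc]
      _ = siteNorm κ h y * (κ⁻¹ * decay (κ / 2) S y) := (sum_mul _ _ _).symm
      _ ≤ h.norm κ * (κ⁻¹ * decay (κ / 2) S y) := by
          gcongr
          exact siteNorm_le_norm κ h y
      _ = _ := by ring
  calc _ ≤ ∑ y ∈ Y, ∑ X with y ∈ X, ‖h.term X‖ * ∑ x ∈ X, decay (κ / 2) S x :=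
        sum_not_disjoint_le Y fun X =>
          mul_nonneg (_root_.norm_nonneg _) (sum_decay_nonneg (κ / 2) S X)
    _ ≤ ∑ y ∈ Y, h.norm κ / κ * decay (κ / 2) S y := sum_le_sum fun y _ => hsite y
    _ = _ := (mul_sum _ _ _).symm

/-- The sum of the local terms of `h` on the sets that meet `Y`. -/
def opTouching (h : ExtOp d L q) (Y : Finset (Site d L)) : Op d L q :=
  ∑ X with ¬ Disjoint Y X, h.term X

theorem op_sub_opTouching (h : ExtOp d L q) (Y : Finset (Site d L)) :
    h.op - opTouching h Y = ∑ X with Disjoint Y X, h.term X :=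
  sub_eq_of_eq_add (sum_filter_add_sum_filter_not univ (Disjoint Y) h.term).symm

theorem commute_op_sub_opTouching (h : ExtOp d L q) {Y : Finset (Site d L)} {B : Op d L q}
    (hB : SupportedOn Y B) : Commute (h.op - opTouching h Y) B := by
  rw [op_sub_opTouching]
  exact Commute.sum_left _ _ _ fun X hX => (h.supported X).commute hB (mem_filter.1 hX).2.symm

theorem isSelfAdjoint_op_sub_opTouching {h : ExtOp d L q} (hsa : h.SelfAdj)
    (Y : Finset (Site d L)) : IsSelfAdjoint (h.op - opTouching h Y) := by
  rw [op_sub_opTouching]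
  exact sum_induction _ _ (fun _ _ => IsSelfAdjoint.add) (.zero _) fun X _ => hsa X

/-- The commutators of the Heisenberg evolution of `O` under `h` with observables supported on `Y`
are bounded, with constant `M`, in terms of the weight of `Y`. -/
def CommutatorBound (κ : ℝ) (h : ExtOp d L q) (S : Finset (Site d L)) (O : Op d L q) (M : ℝ) :
    Prop :=
  ∀ t : ℝ, 0 ≤ t → ∀ Y : Finset (Site d L), Y.Nonempty → ∀ B : Op d L q, SupportedOn Y B →
    ‖⁅heisenberg h.op t O, B⁆‖ ≤
      M * (‖B‖ * Real.exp (4 * h.norm κ / κ * t) * ∑ y ∈ Y, decay (κ / 2) S y)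

theorem norm_le_add_of_norm_deriv_le_exp {E : Type*} [NormedAddCommGroup E] [NormedSpace ℝ E]
    {f f' : ℝ → E} (hf : ∀ s, HasDerivAt f (f' s) s) {a c rate : ℝ} (hinit : ‖f 0‖ ≤ a)
    (hderiv : ∀ s, 0 ≤ s → ‖f' s‖ ≤ c * (Real.exp (rate * s) * rate)) {t : ℝ} (ht : 0 ≤ t) :
    ‖f t‖ ≤ a + c * (Real.exp (rate * t) - 1) := by
  have hmajorant (s : ℝ) : HasDerivAt (fun s => a + c * (Real.exp (rate * s) - 1))
      (c * (Real.exp (rate * s) * rate)) s := by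
    have hlin : HasDerivAt (fun s => rate * s) rate s := by
      simpa using (hasDerivAt_id s).const_mul rate
    exact ((hlin.exp.sub_const 1).const_mul c).const_add a
  exact image_norm_le_of_norm_deriv_right_le_deriv_boundary
    (fun s _ => (hf s).continuousAt.continuousWithinAt) (fun s _ => (hf s).hasDerivWithinAt)
    (by simpa using hinit) hmajorant (fun s hs => hderiv s hs.1) ⟨ht, le_rfl⟩

theorem hasDerivAt_heisenberg_neg_lie {𝔸 : Type*} [CStarAlgebra 𝔸] {H K B : 𝔸} (O : 𝔸)
    (hKB : Commute K B) (s : ℝ) :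
    HasDerivAt (fun s => heisenberg (-K) s ⁅heisenberg H s O, B⁆)
      (heisenberg (-K) s (Complex.I • ⁅⁅H - K, heisenberg H s O⁆, B⁆)) s := by
  have hX := hasDerivAt_heisenberg' H O s
  refine (hasDerivAt_heisenberg_apply (-K) ((hX.mul_const B).sub (hX.const_mul B))).congr_deriv ?_
  set X := heisenberg H s O
  have hjacobi : ⁅K, ⁅X, B⁆⁆ = ⁅⁅K, X⁆, B⁆ := by
    rw [leibniz_lie, hKB.lie_eq, lie_zero, add_zero]
  have hlie : Complex.I • ⁅H, X⁆ * B - B * Complex.I • ⁅H, X⁆ = Complex.I • ⁅⁅H, X⁆, B⁆ := by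
    rw [Ring.lie_def ⁅H, X⁆, smul_mul_assoc, mul_smul_comm, smul_sub]
  change heisenberg (-K) s (Complex.I • ⁅-K, ⁅X, B⁆⁆ + _) = _
  rw [hlie, ← smul_add, neg_lie, hjacobi, sub_lie, sub_lie, neg_add_eq_sub]

variable {h : ExtOp d L q} {O : Op d L q} {M : ℝ}

theorem norm_lie_le_sum_decay (hO : SupportedOn S O) {Y : Finset (Site d L)} {B : Op d L q}
    (hB : SupportedOn Y B) (μ : ℝ) : ‖⁅O, B⁆‖ ≤ 2 * ‖O‖ * (‖B‖ * ∑ y ∈ Y, decay μ S y) := by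
  by_cases hd : Disjoint S Y
  · have hw := sum_decay_nonneg μ S Y
    rw [(hO.commute hB hd).lie_eq, _root_.norm_zero]
    positivity
  · obtain ⟨y, hyS, hyY⟩ := not_disjoint_iff.1 hd
    have hw : 1 ≤ ∑ y ∈ Y, decay μ S y := (one_le_decay μ hyS).trans (decay_le_sum_decay μ S hyY)
    calc ‖⁅O, B⁆‖ ≤ 2 * ‖O‖ * ‖B‖ := norm_lie_le O B
      _ ≤ _ := by
          gcongr
          exact le_mul_of_one_le_right (_root_.norm_nonneg B) hw

namespace CommutatorBound

theorem mono {M' : ℝ} (hb : CommutatorBound κ h S O M) (hM : M ≤ M') :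
    CommutatorBound κ h S O M' := fun t ht Y hY B hB => (hb t ht Y hY B hB).trans (by
  have := sum_decay_nonneg (κ / 2) S Y
  gcongr)

theorem of_forall_le_decay (hκ : 0 < κ) (hsa : h.SelfAdj) (O : Op d L q) {m : ℝ} (hm : 0 < m)
    (hdecay : ∀ y, m ≤ decay (κ / 2) S y) : CommutatorBound κ h S O (2 * ‖O‖ / m) := by
  rintro t ht Y ⟨y, hy⟩ B -
  have hw : m ≤ ∑ y ∈ Y, decay (κ / 2) S y := (hdecay y).trans (decay_le_sum_decay _ S hy)
  have hnorm := ExtOp.norm_nonneg κ h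
  have hexp : 1 ≤ Real.exp (4 * h.norm κ / κ * t) := Real.one_le_exp (by positivity)
  calc _ ≤ 2 * ‖heisenberg h.op t O‖ * ‖B‖ := norm_lie_le _ _
    _ = 2 * ‖O‖ / m * (‖B‖ * 1 * m) := by rw [norm_heisenberg hsa.op]; field_simp
    _ ≤ _ := by gcongr

theorem norm_lie_opTouching_le (hb : CommutatorBound κ h S O M) (hκ : 0 < κ) (hM : 0 ≤ M)
    (Y : Finset (Site d L)) {s : ℝ} (hs : 0 ≤ s) :
    ‖⁅opTouching h Y, heisenberg h.op s O⁆‖ ≤ M * Real.exp (4 * h.norm κ / κ * s) *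
      (h.norm κ / κ * ∑ y ∈ Y, decay (κ / 2) S y) :=
  calc _ ≤ ∑ X with ¬ Disjoint Y X, ‖⁅h.term X, heisenberg h.op s O⁆‖ := by
        rw [opTouching, sum_lie]
        exact norm_sum_le _ _
    _ ≤ ∑ X with ¬ Disjoint Y X, M * Real.exp (4 * h.norm κ / κ * s) *
          (‖h.term X‖ * ∑ x ∈ X, decay (κ / 2) S x) := sum_le_sum fun X _ => by
        by_cases hc : IsConn X
        · rw [← lie_skew, _root_.norm_neg]
          exact (hb s hs X hc.nonempty _ (h.supported X)).trans_eq (by ring)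
        · simp [h.term_eq_zero X hc]
    _ ≤ _ := by
        rw [← mul_sum]
        gcongr
        exact sum_norm_term_mul_decay_le hκ S Y h

/-- In the interaction picture of the terms that do not meet `Y`, the commutator with `B` changes
only through the terms that do, and for these the bound with constant `M` is available. -/
theorem improve (hb : CommutatorBound κ h S O M) (hκ : 0 < κ) (hsa : h.SelfAdj)
    (hO : SupportedOn S O) (hM : 0 ≤ M) : CommutatorBound κ h S O (2 * ‖O‖ + M / 2) := by
  intro t ht Y _ B hB
  set w := ∑ y ∈ Y, decay (κ / 2) S y
  set rate := 4 * h.norm κ / κ with hrate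
  set K := h.op - opTouching h Y with hK
  have hw : 0 ≤ w := sum_decay_nonneg _ _ _
  have hrate₀ : 0 ≤ rate := by have := ExtOp.norm_nonneg κ h; positivity
  have hKsa : IsSelfAdjoint (-K) := (isSelfAdjoint_op_sub_opTouching hsa Y).neg
  have hinit : ‖heisenberg (-K) 0 ⁅heisenberg h.op 0 O, B⁆‖ ≤ 2 * ‖O‖ * (‖B‖ * w) := by
    rw [heisenberg_zero_time, heisenberg_zero_time]
    exact norm_lie_le_sum_decay hO hB (κ / 2)
  have hderiv (s : ℝ) (hs : 0 ≤ s) :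
      ‖heisenberg (-K) s (Complex.I • ⁅⁅h.op - K, heisenberg h.op s O⁆, B⁆)‖ ≤
        M / 2 * (‖B‖ * w) * (Real.exp (rate * s) * rate) := by
    rw [norm_heisenberg hKsa, norm_smul, Complex.norm_I, one_mul, hK, sub_sub_cancel]
    calc _ ≤ 2 * ‖⁅opTouching h Y, heisenberg h.op s O⁆‖ * ‖B‖ := norm_lie_le _ _
      _ ≤ 2 * (M * Real.exp (rate * s) * (h.norm κ / κ * w)) * ‖B‖ := by
          gcongr
          exact hb.norm_lie_opTouching_le hκ hM Y hs
      _ = _ := by rw [hrate]; ring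
  have hbound := norm_le_add_of_norm_deriv_le_exp
    (hasDerivAt_heisenberg_neg_lie O (commute_op_sub_opTouching h hB)) hinit hderiv ht
  rw [norm_heisenberg hKsa] at hbound
  have hexp : 1 ≤ Real.exp (rate * t) := Real.one_le_exp (by positivity)
  calc _ ≤ 2 * ‖O‖ * (‖B‖ * w) * 1 + M / 2 * (‖B‖ * w) * (Real.exp (rate * t) - 1) := by
        rwa [mul_one]
    _ ≤ 2 * ‖O‖ * (‖B‖ * w) * Real.exp (rate * t) + M / 2 * (‖B‖ * w) * Real.exp (rate * t) := by
        gcongr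
        linarith
    _ = _ := by ring

end CommutatorBound

/-- `4 * ‖O‖` is the fixed point of `M ↦ 2 * ‖O‖ + M / 2`. -/
theorem commutatorBound_four_mul_norm (hκ : 0 < κ) (hsa : h.SelfAdj) (hO : SupportedOn S O)
    (hS : S.Nonempty) : CommutatorBound κ h S O (4 * ‖O‖) := by
  obtain ⟨x₀, hx₀⟩ := Finite.exists_min (decay (κ / 2) S)
  set m := decay (κ / 2) S x₀
  have hm : 0 < m := decay_pos _ hS x₀
  have hiter (k : ℕ) : CommutatorBound κ h S O (4 * ‖O‖ + (1 / 2) ^ k * (2 * ‖O‖ / m)) := by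
    induction k with
    | zero =>
      refine (CommutatorBound.of_forall_le_decay hκ hsa O hm hx₀).mono ?_
      linarith [_root_.norm_nonneg O]
    | succ k ih =>
      refine (ih.improve hκ hsa hO (by positivity)).mono (le_of_eq ?_)
      rw [pow_succ]
      ring
  intro t ht Y hY B hB
  have hlim : Filter.Tendsto (fun k : ℕ => 4 * ‖O‖ + (1 / 2 : ℝ) ^ k * (2 * ‖O‖ / m))
      Filter.atTop (nhds (4 * ‖O‖)) := by
    simpa using ((tendsto_pow_atTop_nhds_zero_of_lt_one (by norm_num)
      (by norm_num : (1 / 2 : ℝ) < 1)).mul_const (2 * ‖O‖ / m)).const_add (4 * ‖O‖)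
  exact ge_of_tendsto' (hlim.mul_const _) fun k => hiter k t ht Y hY B hB

theorem min_one_sum_le {ι : Type*} (s : Finset ι) {f : ι → ℝ} (hf : ∀ i ∈ s, 0 ≤ f i) :
    min 1 (∑ i ∈ s, f i) ≤ ∑ i ∈ s, min 1 (f i) := by
  by_cases h : ∃ i ∈ s, 1 ≤ f i
  · obtain ⟨i, hi, hone⟩ := h
    calc min 1 (∑ i ∈ s, f i) ≤ 1 := min_le_left _ _
      _ = min 1 (f i) := (min_eq_left hone).symm
      _ ≤ _ := single_le_sum (f := fun i => min 1 (f i))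
        (fun j hj => le_min zero_le_one (hf j hj)) hi
  · push Not at h
    refine (min_le_right _ _).trans (sum_le_sum fun i hi => ?_)
    rw [min_eq_right (h i hi).le]

theorem norm_lie_heisenberg_le_sum_min (hκ : 0 < κ) (hsa : h.SelfAdj) (hO : SupportedOn S O)
    (hS : S.Nonempty) {t : ℝ} (ht : 0 ≤ t) {X : Finset (Site d L)} (hX : X.Nonempty)
    {B : Op d L q} (hB : SupportedOn X B) :
    ‖⁅B, heisenberg h.op t O⁆‖ ≤ 4 * ‖O‖ *
      (‖B‖ * ∑ x ∈ X, min 1 (Real.exp (4 * h.norm κ / κ * t) * decay (κ / 2) S x)) := by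
  set g : Site d L → ℝ := fun x => Real.exp (4 * h.norm κ / κ * t) * decay (κ / 2) S x
  have hg (x : Site d L) : 0 ≤ g x := mul_nonneg (Real.exp_pos _).le (decay_nonneg _ _ _)
  have hdecay : ‖⁅B, heisenberg h.op t O⁆‖ ≤ 4 * ‖O‖ * (‖B‖ * ∑ x ∈ X, g x) := by
    rw [← lie_skew, _root_.norm_neg, ← mul_sum, ← mul_assoc ‖B‖]
    exact commutatorBound_four_mul_norm hκ hsa hO hS t ht X hX B hB
  have htrivial : ‖⁅B, heisenberg h.op t O⁆‖ ≤ 4 * ‖O‖ * (‖B‖ * 1) := by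
    have := norm_lie_le B (heisenberg h.op t O)
    rw [norm_heisenberg hsa.op] at this
    nlinarith [mul_nonneg (_root_.norm_nonneg O) (_root_.norm_nonneg B)]
  calc _ ≤ 4 * ‖O‖ * (‖B‖ * min 1 (∑ x ∈ X, g x)) := by
        rcases min_choice 1 (∑ x ∈ X, g x) with e | e <;> rw [e]
        exacts [htrivial, hdecay]
    _ ≤ _ := by
        gcongr
        exact min_one_sum_le X fun x _ => hg x

theorem sum_mul_sum_eq_sum_mul_sum_mem {ι R : Type*} [Fintype ι] [DecidableEq ι] [CommSemiring R]
    (c : Finset ι → R) (g : ι → R) :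
    ∑ X, c X * ∑ x ∈ X, g x = ∑ x, g x * ∑ X with x ∈ X, c X := by
  simp_rw [mul_sum, sum_filter]
  rw [sum_comm (s := univ (α := ι))]
  refine sum_congr rfl fun X _ => ?_
  rw [← sum_filter, filter_mem_eq_inter, univ_inter]
  exact sum_congr rfl fun x _ => mul_comm _ _

theorem norm_lie_op_heisenberg_le (hκ : 0 < κ) {μ : ℝ} (hμ : 0 ≤ μ) (W : ExtOp d L q)
    (hsa : h.SelfAdj) (hO : SupportedOn S O) (hS : S.Nonempty) {t : ℝ} (ht : 0 ≤ t) :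
    ‖⁅W.op, heisenberg h.op t O⁆‖ ≤ 4 * ‖O‖ * W.norm μ *
      ∑ y ∈ S, ∑ x, min 1 (Real.exp (4 * h.norm κ / κ * t - κ / 2 * dist x y)) := by
  set a := 4 * h.norm κ / κ * t
  set g : Site d L → ℝ := fun x => min 1 (Real.exp a * decay (κ / 2) S x) with hg
  have hg₀ (x : Site d L) : 0 ≤ g x :=
    le_min zero_le_one (mul_nonneg (Real.exp_pos _).le (decay_nonneg _ _ _))
  have hW := ExtOp.norm_nonneg μ W
  have hterm (X : Finset (Site d L)) : ‖⁅W.term X, heisenberg h.op t O⁆‖ ≤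
      4 * ‖O‖ * (‖W.term X‖ * ∑ x ∈ X, g x) := by
    by_cases hc : IsConn X
    · exact norm_lie_heisenberg_le_sum_min hκ hsa hO hS ht hc.nonempty (W.supported X)
    · simp [W.term_eq_zero X hc]
  have hsite (x : Site d L) : ∑ X with x ∈ X, ‖W.term X‖ ≤ W.norm μ :=
    (sum_norm_term_le hμ W x).trans (mul_le_of_le_one_left hW (by simpa using hμ))
  have hsum : ∑ x, g x ≤ ∑ y ∈ S, ∑ x, min 1 (Real.exp (a - κ / 2 * dist x y)) := by
    rw [sum_comm]
    refine sum_le_sum fun x _ => ?_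
    simp only [hg, decay, mul_sum, ← Real.exp_add, neg_mul, ← sub_eq_add_neg]
    exact min_one_sum_le S fun y _ => (Real.exp_pos _).le
  calc _ ≤ ∑ X, ‖⁅W.term X, heisenberg h.op t O⁆‖ := by
        conv_lhs => rw [op, sum_lie]
        exact norm_sum_le _ _
    _ ≤ ∑ X, 4 * ‖O‖ * (‖W.term X‖ * ∑ x ∈ X, g x) := sum_le_sum fun X _ => hterm X
    _ = 4 * ‖O‖ * ∑ x, g x * ∑ X with x ∈ X, ‖W.term X‖ := by
        rw [← mul_sum, sum_mul_sum_eq_sum_mul_sum_mem]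
    _ ≤ 4 * ‖O‖ * ∑ x, g x * W.norm μ := by
        gcongr with x
        exacts [hg₀ x, hsite x]
    _ = 4 * ‖O‖ * W.norm μ * ∑ x, g x := by rw [← sum_mul]; ring
    _ ≤ _ := by gcongr

end LiebRobinson

section Counting

open Finset

theorem summable_exp_neg_mul_abs {lam : ℝ} (hlam : 0 < lam) :
    Summable fun m : ℤ => Real.exp (-lam * |(m : ℝ)|) := by
  have h : Summable fun n : ℕ => Real.exp (-lam * |(n : ℝ)|) := by
    refine (summable_geometric_of_lt_one (Real.exp_pos (-lam)).le
      (Real.exp_lt_one_iff.2 (by linarith))).congr fun n => ?_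
    rw [← Real.exp_nat_mul, Nat.abs_cast, mul_comm]
  exact .of_nat_of_neg (by simpa using h) (by simpa using h)

theorem exists_abs_sub_eq_max (k : ℤ) (R : ℕ) :
    ∃ j ∈ Icc (-(R : ℤ)) R, |k - j| = max 0 (|k| - R) :=
  ⟨max (-R) (min k R), by simp, by grind⟩

/-- The plateau of length `2 * b / lam` is covered by translates of `exp (-lam * |k|)`. -/
theorem min_one_exp_le_sum {lam : ℝ} (hlam : 0 < lam) (b : ℝ) (k : ℤ) :
    min 1 (Real.exp (b - lam * |(k : ℝ)|)) ≤
      ∑ j ∈ Icc (-(⌈b / lam⌉₊ : ℤ)) ⌈b / lam⌉₊, Real.exp (-lam * |((k - j : ℤ) : ℝ)|) := by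
  obtain ⟨j, hj, hkj⟩ := exists_abs_sub_eq_max k ⌈b / lam⌉₊
  have hb : b ≤ ⌈b / lam⌉₊ * lam := (div_le_iff₀ hlam).1 (Nat.le_ceil _)
  have hkj' : |((k - j : ℤ) : ℝ)| = max 0 (|(k : ℝ)| - ⌈b / lam⌉₊) := by exact_mod_cast hkj
  refine le_trans ?_ (single_le_sum (f := fun j : ℤ => Real.exp (-lam * |((k - j : ℤ) : ℝ)|))
    (fun _ _ => (Real.exp_pos _).le) hj)
  rw [hkj']
  rcases max_choice 0 (|(k : ℝ)| - ⌈b / lam⌉₊) with h | h <;> rw [h]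
  · simp
  · exact (min_le_right _ _).trans (Real.exp_le_exp.2 (by linarith))

theorem sum_min_one_exp_le {lam b : ℝ} (hlam : 0 < lam) (hb : 0 ≤ b) (s : Finset ℤ) (y : ℤ) :
    ∑ m ∈ s, min 1 (Real.exp (b - lam * |((m - y : ℤ) : ℝ)|)) ≤
      (2 * (b / lam) + 3) * ∑' m : ℤ, Real.exp (-lam * |(m : ℝ)|) := by
  set R := ⌈b / lam⌉₊
  have htranslate (j : ℤ) : ∑ m ∈ s, Real.exp (-lam * |((m - y - j : ℤ) : ℝ)|) ≤
      ∑' m : ℤ, Real.exp (-lam * |(m : ℝ)|) := by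
    have hsummable := (Equiv.subRight (y + j)).summable_iff.2 (summable_exp_neg_mul_abs hlam)
    rw [← (Equiv.subRight (y + j)).tsum_eq]
    simp only [sub_sub]
    exact hsummable.sum_le_tsum s fun _ _ => (Real.exp_pos _).le
  have hcard : (#(Icc (-(R : ℤ)) R) : ℝ) ≤ 2 * (b / lam) + 3 := by
    have h : #(Icc (-(R : ℤ)) R) = 2 * R + 1 := by
      rw [Int.card_Icc]
      lia
    rw [h]
    push_cast
    linarith [Nat.ceil_lt_add_one (div_nonneg hb hlam.le)]
  calc _ ≤ ∑ m ∈ s, ∑ j ∈ Icc (-(R : ℤ)) R, Real.exp (-lam * |((m - y - j : ℤ) : ℝ)|) :=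
        sum_le_sum fun m _ => min_one_exp_le_sum hlam b (m - y)
    _ = ∑ j ∈ Icc (-(R : ℤ)) R, ∑ m ∈ s, Real.exp (-lam * |((m - y - j : ℤ) : ℝ)|) := sum_comm
    _ ≤ #(Icc (-(R : ℤ)) R) • ∑' m : ℤ, Real.exp (-lam * |(m : ℝ)|) :=
        sum_le_card_nsmul _ _ _ fun j _ => htranslate j
    _ ≤ _ := by
        rw [nsmul_eq_mul]
        gcongr

theorem sum_min_one_exp_dist_le {lam b : ℝ} (hlam : 0 < lam) (hb : 0 ≤ b) (L : ℕ)
    (y : Set.Icc (-(L : ℤ)) (L : ℤ)) :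
    ∑ m : Set.Icc (-(L : ℤ)) (L : ℤ), min 1 (Real.exp (b - lam * dist m y)) ≤
      (2 * (b / lam) + 3) * ∑' m : ℤ, Real.exp (-lam * |(m : ℝ)|) := by
  have hmem (z : ℤ) : z ∈ Icc (-(L : ℤ)) L ↔ z ∈ Set.Icc (-(L : ℤ)) (L : ℤ) := by simp
  calc _ = ∑ m : Set.Icc (-(L : ℤ)) (L : ℤ),
        min 1 (Real.exp (b - lam * |(((m : ℤ) - y : ℤ) : ℝ)|)) := by
        simp only [Subtype.dist_eq, Int.dist_eq, Int.cast_sub]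
    _ = ∑ m ∈ Icc (-(L : ℤ)) L, min 1 (Real.exp (b - lam * |((m - y : ℤ) : ℝ)|)) :=
        (sum_subtype _ hmem fun m => min 1 (Real.exp (b - lam * |((m - y : ℤ) : ℝ)|))).symm
    _ ≤ _ := sum_min_one_exp_le hlam hb _ y

variable {d L : ℕ}

theorem min_one_exp_le_prod (hd : 0 < d) (a : ℝ) {μ : ℝ} (hμ : 0 ≤ μ) (x y : Site d L) :
    min 1 (Real.exp (a - μ * dist x y)) ≤
      ∏ i, min 1 (Real.exp (a / d - μ / d * dist (x i) (y i))) := by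
  have hsplit : Real.exp (a - μ * dist x y) = Real.exp (a / d - μ / d * dist x y) ^ d := by
    rw [← Real.exp_nat_mul]
    congr 1
    have : (d : ℝ) ≠ 0 := by exact_mod_cast hd.ne'
    field_simp
  calc _ ≤ min 1 (Real.exp (a / d - μ / d * dist x y)) ^ d := by
        rw [hsplit]
        rcases min_choice 1 (Real.exp (a / d - μ / d * dist x y)) with h | h <;> rw [h]
        exacts [(min_le_left _ _).trans_eq (one_pow d).symm, min_le_right _ _]
    _ = ∏ _i : Fin d, min 1 (Real.exp (a / d - μ / d * dist x y)) := by simp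
    _ ≤ _ := by
        gcongr with i
        exact dist_le_pi_dist x y i

theorem exists_sum_min_one_exp_le (d : ℕ) {μ : ℝ} (hμ : 0 < μ) :
    ∃ K : ℝ, 0 ≤ K ∧ ∀ (L : ℕ) (y : Site d L) (a : ℝ), 0 ≤ a →
      ∑ x, min 1 (Real.exp (a - μ * dist x y)) ≤ K * (1 + a) ^ d := by
  rcases Nat.eq_zero_or_pos d with rfl | hd
  · exact ⟨1, zero_le_one, fun L y a _ => by simp⟩
  set Q : ℝ := ∑' m : ℤ, Real.exp (-(μ / d) * |(m : ℝ)|)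
  have hQ : 0 ≤ Q := tsum_nonneg fun _ => (Real.exp_pos _).le
  refine ⟨((2 / μ + 3) * Q) ^ d, by positivity, fun L y a ha => ?_⟩
  have hlinear : 2 * (a / d / (μ / d)) + 3 ≤ (2 / μ + 3) * (1 + a) := by
    have hcoeff : 0 ≤ 2 / μ := by positivity
    rw [show 2 * (a / d / (μ / d)) = 2 / μ * a by field_simp]
    nlinarith
  calc _ ≤ ∑ x : Site d L, ∏ i, min 1 (Real.exp (a / d - μ / d * dist (x i) (y i))) :=
        sum_le_sum fun x _ => min_one_exp_le_prod hd a hμ.le x y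
    _ = ∏ i, ∑ m : Set.Icc (-(L : ℤ)) (L : ℤ),
          min 1 (Real.exp (a / d - μ / d * dist m (y i))) := by
        rw [prod_univ_sum, Fintype.piFinset_univ]
    _ ≤ ∏ _i : Fin d, ((2 / μ + 3) * (1 + a) * Q) :=
        prod_le_prod (fun i _ => sum_nonneg fun m _ => le_min zero_le_one (Real.exp_pos _).le)
          fun i _ => (sum_min_one_exp_dist_le (by positivity) (by positivity) L (y i)).trans
            (mul_le_mul_of_nonneg_right hlinear hQ)
    _ = _ := by
        rw [prod_const, card_univ, Fintype.card_fin, mul_right_comm, mul_pow]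

end Counting

section Dynamics

open Finset Lattice.ExtOp

variable {d : ℕ} {κ : ℝ}

theorem exists_norm_lie_op_heisenberg_le (d : ℕ) (hκ : 0 < κ) :
    ∃ K : ℝ, 0 ≤ K ∧ ∀ (L q : ℕ) (h W : ExtOp d L q), h.SelfAdj → ∀ b : ℝ, 1 ≤ b →
      h.norm κ ≤ b → ∀ (S : Finset (Site d L)) (O : Op d L q), S.Nonempty → SupportedOn S O →
      ∀ s t : ℝ, 0 ≤ s → s ≤ t → ‖⁅W.op, heisenberg h.op s O⁆‖ ≤
        K * S.card * b ^ d * W.norm (κ / 2) * ‖O‖ * (1 + t) ^ d := by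
  obtain ⟨K, hK, hcount⟩ := exists_sum_min_one_exp_le d (half_pos hκ)
  refine ⟨4 * (K * (1 + 4 / κ) ^ d), by positivity, ?_⟩
  intro L q h W hh b hb hnb S O hS hO s t hs hst
  have hlocal := norm_lie_op_heisenberg_le hκ (half_pos hκ).le W hh hO hS hs
  have hw := ExtOp.norm_nonneg (κ / 2) W
  have hn := ExtOp.norm_nonneg κ h
  generalize W.norm (κ / 2) = w at hlocal hw ⊢
  generalize h.norm κ = n at hlocal hn hnb
  have hradius : 1 + 4 * n / κ * s ≤ (1 + 4 / κ) * b * (1 + t) :=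
    calc _ ≤ 1 + 4 * b / κ * t := by gcongr
      _ = 1 + 4 / κ * (b * t) := by ring
      _ ≤ (1 + 4 / κ) * b * (1 + t) := by
          have hbt : 0 ≤ b * t := by have := hs.trans hst; positivity
          have hcoeff : 0 ≤ 4 / κ * b := by positivity
          nlinarith
  calc _ ≤ 4 * ‖O‖ * w * ∑ y ∈ S, ∑ x, min 1 (Real.exp (4 * n / κ * s - κ / 2 * dist x y)) :=
        hlocal
    _ ≤ 4 * ‖O‖ * w * (S.card • (K * ((1 + 4 / κ) * b * (1 + t)) ^ d)) := by
        gcongr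
        refine sum_le_card_nsmul _ _ _ fun y _ => (hcount L y _ (by positivity)).trans ?_
        gcongr
    _ = _ := by rw [nsmul_eq_mul, mul_pow, mul_pow]; ring

theorem exists_norm_heisenberg_sub_heisenberg_le (d : ℕ) (hκ : 0 < κ) :
    ∃ K : ℝ, 0 ≤ K ∧ ∀ (L q : ℕ) (h W : ExtOp d L q), h.SelfAdj → W.SelfAdj → ∀ b : ℝ, 1 ≤ b →
      h.norm κ ≤ b → ∀ (S : Finset (Site d L)) (O : Op d L q), S.Nonempty → SupportedOn S O →
      ∀ t : ℝ, ‖heisenberg h.op t O - heisenberg (h.op - W.op) t O‖ ≤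
        K * S.card * b ^ d * W.norm (κ / 2) * ‖O‖ * (|t| * (1 + |t|) ^ d) := by
  obtain ⟨K, hK, hlie⟩ := exists_norm_lie_op_heisenberg_le d hκ
  refine ⟨K, hK, fun L q h W hh hW b hb hnb S O hS hO t => ?_⟩
  rcases le_total 0 t with ht | ht
  · rw [abs_of_nonneg ht]
    exact (norm_heisenberg_sub_heisenberg_le hh.op hW.op ht O fun s hs hst =>
      hlie L q h W hh b hb hnb S O hS hO s t hs hst).trans_eq (by ring)
  · have hneg := norm_heisenberg_sub_heisenberg_le hh.neg.op hW.neg.op (neg_nonneg.2 ht) O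
      fun s hs hst =>
        hlie L q (-h) (-W) hh.neg b hb (by rwa [ExtOp.norm_neg]) S O hS hO s (-t) hs hst
    rw [ExtOp.norm_neg, op_neg, op_neg, ← neg_sub', heisenberg_neg, heisenberg_neg,
      neg_neg] at hneg
    rw [abs_of_nonpos ht]
    exact hneg.trans_eq (by ring)

end Dynamics

section Rounding

open Complex

variable {𝔸 : Type*} [CStarAlgebra 𝔸]

theorem four_mul_abs_sub_round_le (x : ℝ) :
    4 * |x - round x| ≤ ‖exp (I * (2 * Real.pi : ℝ) * x) - 1‖ := by
  have hperiod : exp (I * (2 * Real.pi : ℝ) * x) =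
      exp (I * (2 * (Real.pi * (x - round x)) : ℝ)) := by
    rw [← mul_one (exp (I * (2 * (Real.pi * (x - round x)) : ℝ))),
      ← exp_int_mul_two_pi_mul_I (round x), ← exp_add]
    push_cast
    ring_nf
  have hangle : |Real.pi * (x - round x)| = Real.pi * |x - round x| := by
    rw [abs_mul, abs_of_pos Real.pi_pos]
  have hjordan := Real.mul_abs_le_abs_sin (x := Real.pi * (x - round x)) <| by
    rw [hangle]
    linarith [mul_le_mul_of_nonneg_left (abs_sub_round x) Real.pi_pos.le]
  rw [hangle, ← mul_assoc, div_mul_cancel₀ _ Real.pi_ne_zero] at hjordan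
  rw [hperiod, norm_exp_I_mul_ofReal_sub_one, mul_div_cancel_left₀ _ two_ne_zero, norm_mul,
    Real.norm_ofNat, Real.norm_eq_abs]
  linarith

theorem norm_exp_sub_one_le_norm_propagator_sub_one {H : 𝔸} (hH : IsSelfAdjoint H) (t : ℝ) {z : ℂ}
    (hz : z ∈ spectrum ℂ H) : ‖exp (I * t * z) - 1‖ ≤ ‖(propagator H t - 1 : 𝔸)‖ := by
  have := hH.isStarNormal
  have hcfc : (propagator H t - 1 : 𝔸) = cfc (fun z : ℂ => exp ((I * t) • z) - 1) H := by
    rw [cfc_sub _ _ H, cfc_const_one ℂ H, cfc_comp_smul _ _ H,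
      CFC.complex_exp_eq_normedSpace_exp (p := IsStarNormal), coe_propagator]
  rw [hcfc]
  exact norm_apply_le_norm_cfc (fun z : ℂ => exp ((I * t) • z) - 1) H hz

/-- The operator obtained from a self-adjoint operator by rounding its spectrum to integers. It is
meaningful when the spectrum is finite, so that the rounding is continuous on it. -/
def roundSpectrum (H : 𝔸) : 𝔸 := cfc (fun z : ℂ => (round z.re : ℂ)) H

theorem isSelfAdjoint_roundSpectrum (H : 𝔸) : IsSelfAdjoint (roundSpectrum H) := by
  rw [isSelfAdjoint_iff, roundSpectrum, ← cfc_star]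
  simp

theorem commute_roundSpectrum {H : 𝔸} (hH : IsSelfAdjoint H) : Commute H (roundSpectrum H) := by
  have := hH.isStarNormal
  simpa only [cfc_id' ℂ H, roundSpectrum] using
    cfc_commute_cfc (fun z : ℂ => z) (fun z : ℂ => (round z.re : ℂ)) H

variable {H : 𝔸} (hH : IsSelfAdjoint H) (hfin : (spectrum ℂ H).Finite)

include hH hfin

theorem exists_int_of_mem_spectrum_roundSpectrum :
    ∀ z ∈ spectrum ℂ (roundSpectrum H), ∃ n : ℤ, z = n := by
  rw [roundSpectrum, cfc_map_spectrum _ H hH.isStarNormal (hfin.continuousOn _)]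
  rintro _ ⟨w, -, rfl⟩
  exact ⟨round w.re, rfl⟩

/-- By Jordan's inequality the distance to the integers is controlled by `e^{2πix} - 1`, which
vanishes at `N`. -/
theorem norm_sub_roundSpectrum_le {N : 𝔸} (hN : IsSelfAdjoint N)
    (hint : ∀ z ∈ spectrum ℂ N, ∃ n : ℤ, z = n) :
    ‖H - roundSpectrum H‖ ≤ Real.pi / 2 * ‖H - N‖ := by
  have := hH.isStarNormal
  have hcfc : H - roundSpectrum H = cfc (fun z : ℂ => z - (round z.re : ℂ)) H := by
    rw [cfc_sub (fun z => z) _ H (hfin.continuousOn _) (hfin.continuousOn _), cfc_id' ℂ H,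
      roundSpectrum]
  rw [hcfc]
  refine norm_cfc_le (by positivity) fun z hz => ?_
  have hre : z = z.re := hH.mem_spectrum_eq_re hz
  have hdist : ‖z - (round z.re : ℂ)‖ = |z.re - round z.re| := by
    rw [← Real.norm_eq_abs, ← norm_real, ofReal_sub, ← hre, ofReal_intCast]
  have hpropagator : ‖(propagator H (2 * Real.pi) - 1 : 𝔸)‖ ≤ 2 * Real.pi * ‖H - N‖ := by
    have h := norm_propagator_sub_propagator_le hH hN (2 * Real.pi)
    rwa [propagator_two_pi hN hint, abs_of_pos Real.two_pi_pos, Units.val_one] at h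
  have hjordan := four_mul_abs_sub_round_le z.re
  rw [← hre] at hjordan
  have hspec := norm_exp_sub_one_le_norm_propagator_sub_one hH (2 * Real.pi) hz
  linarith

end Rounding

end Prethermal

namespace Lattice.ExtOp

open Prethermal Finset

variable {d L q : ℕ}

section WholeBox

/-- An operator on the box, as an extensive local operator whose only term is that of the whole
box. -/
def ofOp (A : Op d L q) : ExtOp d L q where
  term S := if S = univ then A else 0
  supported S := by
    split_ifs with h
    · exact h ▸ supportedOn_univ A
    · exact supportedOn_zero S
  term_eq_zero S hS := if_neg fun h : S = univ => hS (by rw [h]; exact isConn_univ)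

@[simp] theorem op_ofOp (A : Op d L q) : (ofOp A).op = A := by
  simp [op, ofOp]

theorem selfAdj_ofOp {A : Op d L q} (hA : IsSelfAdjoint A) : (ofOp A).SelfAdj := by
  intro S
  simp only [ofOp]
  split_ifs
  exacts [hA, .zero _]

end WholeBox

section OnSite

theorem norm_term_singleton_le {μ : ℝ} (hμ : 0 ≤ μ) (A : ExtOp d L q) (x : Site d L) :
    ‖A.term {x}‖ ≤ Real.exp (-μ) * A.norm μ :=
  calc ‖A.term {x}‖ ≤ ∑ S with x ∈ S, ‖A.term S‖ :=
        single_le_sum (f := fun S : Finset (Site d L) => ‖A.term S‖)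
          (fun _ _ => _root_.norm_nonneg _) (mem_filter.2 ⟨mem_univ _, mem_singleton_self x⟩)
    _ ≤ Real.exp (-μ) * A.norm μ := sum_norm_term_le hμ A x

variable {N : ExtOp d L q}

theorem OnSite.lie_op_eq_lie_term (hN : N.OnSite) {x : Site d L} {A : Op d L q}
    (hA : SupportedOn {x} A) : ⁅N.op, A⁆ = ⁅N.term {x}, A⁆ := by
  rw [op, sum_lie, sum_eq_single {x} (fun T _ hT => ?_) (by simp)]
  by_cases hcard : T.card = 1
  · obtain ⟨y, rfl⟩ := card_eq_one.1 hcard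
    have hne : y ≠ x := fun h => hT (by rw [h])
    exact ((N.supported {y}).commute hA (by simpa using hne)).lie_eq
  · rw [hN T hcard, zero_lie]

/-- The commutator `X = [N, A]` satisfies `X = i [N_x, G]`, where the average `G` of `X` has norm at
most `π ‖X‖`. -/
theorem OnSite.commute_op_of_two_pi_mul_norm_lt_one (hN : N.OnSite) (hsa : N.SelfAdj)
    (hper : ∀ A, heisenberg N.op (2 * Real.pi) A = A) {x : Site d L}
    (hsmall : 2 * Real.pi * ‖N.term {x}‖ < 1) {A : Op d L q} (hA : SupportedOn {x} A) :
    Commute N.op A := by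
  set X := ⁅N.op, A⁆ with hX
  set G := Prethermal.flowAverage sawtooth N.op X
  have hX_supp : SupportedOn {x} X := by
    rw [hX, hN.lie_op_eq_lie_term hA]
    exact (N.supported {x}).lie hA
  have hG_norm : ‖G‖ ≤ Real.pi * ‖X‖ :=
    Prethermal.norm_flowAverage_le hsa.op (fun _ => abs_sawtooth_le) X
  have hXG : X = Complex.I • ⁅N.term {x}, G⁆ := by
    rw [← hN.lie_op_eq_lie_term (hN.supportedOn_flowAverage hX_supp _)]
    exact (I_smul_lie_flowAverage_lie (hper A)).symm
  have hcontract : ‖X‖ ≤ 2 * Real.pi * ‖N.term {x}‖ * ‖X‖ :=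
    calc ‖X‖ = ‖⁅N.term {x}, G⁆‖ := by rw [hXG, norm_smul, Complex.norm_I, one_mul]
      _ ≤ 2 * ‖N.term {x}‖ * ‖G‖ := norm_lie_le _ _
      _ ≤ 2 * ‖N.term {x}‖ * (Real.pi * ‖X‖) := by gcongr
      _ = 2 * Real.pi * ‖N.term {x}‖ * ‖X‖ := by ring
  have hX_zero : ‖X‖ = 0 := by nlinarith [_root_.norm_nonneg X]
  exact commute_iff_lie_eq.2 (norm_eq_zero.1 hX_zero)

theorem OnSite.commute_op_of_forall_two_pi_mul_norm_lt_one (hN : N.OnSite) (hsa : N.SelfAdj)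
    (hper : ∀ A, heisenberg N.op (2 * Real.pi) A = A)
    (hsmall : ∀ x, 2 * Real.pi * ‖N.term {x}‖ < 1) (A : Op d L q) : Commute N.op A := by
  have hempty : SupportedOn ∅ N.op := supportedOn_iff_commute_siteUnit.2 fun x _ i j =>
    hN.commute_op_of_two_pi_mul_norm_lt_one hsa hper (hsmall x) (supportedOn_siteUnit x i j)
  exact hempty.commute (supportedOn_univ A) (disjoint_empty_left _)

end OnSite

end Lattice.ExtOp

namespace Prethermal

open Real Lattice.ExtOp

variable {d L q : ℕ} {N H P : ExtOp d L q} {κ p x η : ℝ}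

section Constants

theorem eighth_pow_floor_le_exp (x : ℝ) : (1 / 8 : ℝ) ^ ⌊x⌋₊ ≤ exp (1 - x) := by
  have heighth : (1 / 8 : ℝ) ≤ exp (-1) := by
    rw [exp_neg, one_div]
    exact inv_anti₀ (exp_pos 1) (by linarith [exp_one_lt_d9])
  calc (1 / 8 : ℝ) ^ ⌊x⌋₊ ≤ exp (-1) ^ ⌊x⌋₊ := by gcongr
    _ = exp (⌊x⌋₊ * -1) := (exp_nat_mul _ _).symm
    _ ≤ exp (1 - x) := exp_le_exp.2 (by linarith [Nat.lt_floor_add_one x])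

theorem exp_neg_le_exp_neg_one_div {x : ℝ} (hx : 0 < x) : exp (-x) ≤ exp (-1) / x :=
  (le_div_iff₀' hx).2 (mul_exp_neg_le_exp_neg_one x)

theorem exp_neg_mul_exp_one_sub_le (hκ : 0 < κ) (x : ℝ) :
    exp (-(3 * κ / 4)) * exp (1 - x) ≤ 4 / (3 * κ) * exp (-x) :=
  calc exp (-(3 * κ / 4)) * exp (1 - x)
      ≤ exp (-1) / (3 * κ / 4) * exp (1 - x) := by
        gcongr
        exact exp_neg_le_exp_neg_one_div (by positivity)
    _ = 4 / (3 * κ) * (exp (-1) * exp (1 - x)) := by field_simp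
    _ = 4 / (3 * κ) * exp (-x) := by rw [← exp_add]; ring_nf

theorem one_le_exp_one_div_sub_one : 1 ≤ exp 1 / (exp 1 - 1) :=
  (one_le_div (sub_pos.2 (one_lt_exp_iff.2 one_pos))).2 (sub_le_self _ zero_le_one)

theorem mul_le_of_step_condition {y : ℝ} (hy : 0 ≤ y)
    (h : y * (64 * π * (3 * (exp 1 - 1) + exp 1 ^ 2)) ≤ (exp 1 - 1) * κ) :
    400 * π * y ≤ κ := by
  have he : 0 < exp 1 - 1 := sub_pos.2 (one_lt_exp_iff.2 one_pos)
  have hconst : 25 * (exp 1 - 1) ≤ 4 * (3 * (exp 1 - 1) + exp 1 ^ 2) := by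
    nlinarith [sq_nonneg (exp 1 - 13 / 8)]
  refine le_of_mul_le_mul_left (le_trans ?_ h) he
  calc (exp 1 - 1) * (400 * π * y) = 16 * π * y * (25 * (exp 1 - 1)) := by ring
    _ ≤ 16 * π * y * (4 * (3 * (exp 1 - 1) + exp 1 ^ 2)) := by gcongr
    _ = y * (64 * π * (3 * (exp 1 - 1) + exp 1 ^ 2)) := by ring

theorem mul_one_add_pow_le {t : ℝ} (hx : 0 ≤ x) (ht : |t| ≤ exp (x / (d + 1))) :
    |t| * (1 + |t|) ^ d ≤ 2 ^ d * exp x := by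
  have hone : 1 ≤ exp (x / (d + 1)) := one_le_exp (by positivity)
  calc |t| * (1 + |t|) ^ d ≤ exp (x / (d + 1)) * (2 * exp (x / (d + 1))) ^ d := by
        gcongr
        linarith
    _ = 2 ^ d * exp (x / (d + 1)) ^ (d + 1) := by rw [mul_pow, pow_succ]; ring
    _ = 2 ^ d * exp x := by
        rw [← exp_nat_mul, Nat.cast_succ, mul_div_cancel₀ _ (by positivity)]

end Constants

/-- An approximate splitting of `H = N + P` into an operator `number` with integer spectrum and a
commuting operator `dressed`, up to a `remainder`. Here `p` bounds the local norm of `P`, and `η` is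
the relative size of the remainder. -/
structure Splitting (N H : ExtOp d L q) (κ p η : ℝ) where
  number : ExtOp d L q
  dressed : ExtOp d L q
  remainder : ExtOp d L q
  selfAdj_number : number.SelfAdj
  selfAdj_dressed : dressed.SelfAdj
  selfAdj_remainder : remainder.SelfAdj
  op_eq : (number + dressed + remainder).op = H.op
  intSpectrum_number : IntSpectrum number.op
  commute : Commute number.op dressed.op
  norm_remainder_le : remainder.norm (κ / 2) ≤ 2 * (p * η)
  norm_number_sub_le : ‖number.op - N.op‖ ≤
    Fintype.card (Site d L) * (8 * π * exp (-(5 * κ / 4)) * (p * N.norm κ))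
  norm_lie_number_le : ‖⁅H.op, number.op⁆‖ ≤
    Fintype.card (Site d L) * (2 * exp (-(3 * κ / 4)) * (p * η) * N.norm (3 * κ / 4))
  norm_lie_dressed_le : ‖⁅H.op, dressed.op⁆‖ ≤
    Fintype.card (Site d L) * (4 * exp (-(3 * κ / 4)) * (p * η) * p)

namespace NormalForm

variable {δ : ℝ} {k : ℕ} (F : NormalForm N H.op κ δ p k)

theorem norm_lie_op_back_of_commute {B : ExtOp d L q} (hB : Commute (N + F.Z).op B.op) :
    ‖⁅H.op, (F.back B).op⁆‖ = ‖⁅F.V.op, B.op⁆‖ :=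
  calc ‖⁅H.op, (F.back B).op⁆‖ = ‖⁅F.conj (N + F.Z + F.V).op, F.conj B.op⁆‖ := by
        rw [F.conj_op, F.op_back]
    _ = ‖F.conj ⁅(N + F.Z + F.V).op, B.op⁆‖ := by
        simp only [LieRing.of_associative_ring_bracket, map_sub, map_mul]
    _ = ‖⁅(N + F.Z + F.V).op, B.op⁆‖ :=
        NonUnitalStarAlgHom.norm_map F.conj F.conj.injective _
    _ = ‖⁅F.V.op, B.op⁆‖ := by rw [op_add, add_lie, hB.lie_eq, zero_add]

variable (hκ : 0 < κ) (hp : 0 ≤ p) (hk : k * δ ≤ κ / 4)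

include hk in
theorem norm_V_le_of_le : F.V.norm (3 * κ / 4) ≤ p * (1 / 8) ^ k :=
  (norm_mono (by linarith) _).trans F.norm_V_le

include hp hk in
theorem norm_Z_le_of_le : F.Z.norm (3 * κ / 4) ≤ 2 * p := by
  refine (norm_mono (by linarith) _).trans (F.norm_Z_le.trans ?_)
  have hpow : (0 : ℝ) ≤ (1 / 8) ^ k := by positivity
  nlinarith

include hκ hk in
theorem norm_back_le_of_le (B : ExtOp d L q) :
    (F.back B).norm (κ / 2) ≤ 2 * B.norm (3 * κ / 4) := by
  have hpow : (0 : ℝ) ≤ (1 / 2) ^ k := by positivity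
  have hB := norm_nonneg (3 * κ / 4) B
  refine (norm_mono (by linarith) _).trans
    ((F.norm_back_le (3 * κ / 4) (by linarith) le_rfl B).trans ?_)
  nlinarith

include hκ hp in
theorem norm_op_back_sub_le : ‖(F.back N).op - N.op‖ ≤
    Fintype.card (Site d L) * (8 * π * exp (-(5 * κ / 4)) * (p * N.norm κ)) := by
  rw [F.op_back]
  refine F.norm_conj_sub_le.trans (mul_le_mul_of_nonneg_left ?_ (Nat.cast_nonneg _))
  have hN := norm_nonneg κ N
  generalize N.norm κ = n at *
  have hpow : (0 : ℝ) ≤ (1 / 8) ^ k := by positivity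
  calc 8 / 7 * (1 - (1 / 8) ^ k) * (2 * (exp (-(3 * κ / 4)) * (π * p)) * (exp (-κ) * n))
      ≤ 8 / 7 * 1 * (2 * (exp (-(3 * κ / 4)) * (π * p)) * (exp (-κ) * n)) := by
        gcongr
        linarith
    _ = 16 / 7 * π * exp (-(3 * κ / 4) + -κ) * (p * n) := by rw [exp_add]; ring
    _ ≤ 8 * π * exp (-(5 * κ / 4)) * (p * n) := by
        gcongr
        · norm_num
        · linarith

include hκ hp hk in
theorem norm_lie_op_back_le {B : ExtOp d L q} (hB : Commute (N + F.Z).op B.op)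
    (hη : (1 / 8) ^ k ≤ η) : ‖⁅H.op, (F.back B).op⁆‖ ≤
      Fintype.card (Site d L) * (2 * exp (-(3 * κ / 4)) * (p * η) * B.norm (3 * κ / 4)) := by
  rw [F.norm_lie_op_back_of_commute hB]
  have hV : F.V.norm (3 * κ / 4) ≤ p * η := (F.norm_V_le_of_le hk).trans (by gcongr)
  have hpη : 0 ≤ p * η := (norm_nonneg _ _).trans hV
  have hB := norm_nonneg (3 * κ / 4) B
  refine (norm_lie_op_op_le (μ := 3 * κ / 4) (ν := 3 * κ / 4) (by positivity) (by positivity)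
    F.V B).trans (mul_le_mul_of_nonneg_left ?_ (Nat.cast_nonneg _))
  generalize B.norm (3 * κ / 4) = b at *
  generalize F.V.norm (3 * κ / 4) = v at *
  have hexp : exp (-(3 * κ / 4)) ≤ 1 := exp_le_one_iff.2 (by linarith)
  calc 2 * (exp (-(3 * κ / 4)) * v) * (exp (-(3 * κ / 4)) * b)
      ≤ 2 * (exp (-(3 * κ / 4)) * (p * η)) * (1 * b) := by gcongr
    _ = 2 * exp (-(3 * κ / 4)) * (p * η) * b := by ring

/-- Rotating a normal form back to the original frame. -/
def toSplitting (hsa : N.SelfAdj) (hint : IntSpectrum N.op) (hη : (1 / 8) ^ k ≤ η) :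
    Splitting N H κ p η where
  number := F.back N
  dressed := F.back F.Z
  remainder := F.back F.V
  selfAdj_number := F.selfAdj_back _ hsa
  selfAdj_dressed := F.selfAdj_back _ F.selfAdj_Z
  selfAdj_remainder := F.selfAdj_back _ F.selfAdj_V
  op_eq := by simp only [op_add, F.op_back, ← map_add, ← F.conj_op]
  intSpectrum_number := by rwa [IntSpectrum, F.op_back, AlgEquiv.spectrum_eq]
  commute := by
    rw [F.op_back, F.op_back]
    exact F.commute_Z.map F.conj
  norm_remainder_le := by
    have hV := F.norm_V_le_of_le hk
    have hpη : p * (1 / 8) ^ k ≤ p * η := by gcongr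
    linarith [F.norm_back_le_of_le hκ hk F.V]
  norm_number_sub_le := F.norm_op_back_sub_le hκ hp
  norm_lie_number_le := F.norm_lie_op_back_le hκ hp hk
    (by rw [op_add]; exact (Commute.refl _).add_left F.commute_Z.symm) hη
  norm_lie_dressed_le := by
    have hpη : 0 ≤ p * η := mul_nonneg hp ((by positivity : (0 : ℝ) ≤ (1 / 8) ^ k).trans hη)
    refine (F.norm_lie_op_back_le hκ hp hk (B := F.Z)
      (by rw [op_add]; exact F.commute_Z.add_left (Commute.refl _)) hη).trans
      (mul_le_mul_of_nonneg_left ?_ (Nat.cast_nonneg _))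
    calc 2 * exp (-(3 * κ / 4)) * (p * η) * F.Z.norm (3 * κ / 4)
        ≤ 2 * exp (-(3 * κ / 4)) * (p * η) * (2 * p) :=
          mul_le_mul_of_nonneg_left (F.norm_Z_le_of_le hp hk) (by positivity)
      _ = _ := by ring

end NormalForm

namespace Splitting

section Existence

/-- The splitting `H = M + (H - M)` without remainder, for `M` a conserved operator. -/
def ofCommute {M : Op d L q} (hH : H.SelfAdj) (hM : IsSelfAdjoint M) (hint : IntSpectrum M)
    (hcomm : Commute H.op M) (hp : 0 ≤ p) (hη : 0 ≤ η) (hdist : ‖M - N.op‖ ≤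
      Fintype.card (Site d L) * (8 * π * exp (-(5 * κ / 4)) * (p * N.norm κ))) :
    Splitting N H κ p η where
  number := ofOp M
  dressed := ofOp (H.op - M)
  remainder := 0
  selfAdj_number := selfAdj_ofOp hM
  selfAdj_dressed := selfAdj_ofOp (hH.op.sub hM)
  selfAdj_remainder := .zero
  op_eq := by simp
  intSpectrum_number := by rwa [op_ofOp]
  commute := by
    rw [op_ofOp, op_ofOp]
    exact hcomm.symm.sub_right (Commute.refl M)
  norm_remainder_le := by
    rw [ExtOp.norm_zero]
    positivity
  norm_number_sub_le := by rwa [op_ofOp]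
  norm_lie_number_le := by
    have hN := norm_nonneg (3 * κ / 4) N
    rw [op_ofOp, hcomm.lie_eq, _root_.norm_zero]
    exact mul_nonneg (Nat.cast_nonneg _) (mul_nonneg (by positivity) hN)
  norm_lie_dressed_le := by
    rw [op_ofOp, ((Commute.refl H.op).sub_right hcomm).lie_eq, _root_.norm_zero]
    positivity

variable (hon : N.OnSite) (hN : N.SelfAdj) (hP : P.SelfAdj) (hint : IntSpectrum N.op) (hκ : 0 < κ)
  (hp : P.norm κ ≤ p)

include hN hP hint hκ hp in
theorem norm_roundSpectrum_sub_le (hN_large : 1 ≤ 2 * π * (exp (-κ) * N.norm κ)) :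
    ‖roundSpectrum (N + P).op - N.op‖ ≤
      Fintype.card (Site d L) * (8 * π * exp (-(5 * κ / 4)) * (p * N.norm κ)) := by
  have hP_op : ‖P.op‖ ≤ Fintype.card (Site d L) * (exp (-κ) * p) :=
    (norm_op_le hκ.le P).trans (by gcongr)
  have hp₀ : 0 ≤ p := (norm_nonneg _ _).trans hp
  have hround : ‖(N + P).op - roundSpectrum (N + P).op‖ ≤ π / 2 * ‖P.op‖ := by
    simpa using norm_sub_roundSpectrum_le (hN.add hP).op (Matrix.finite_spectrum _) hN.op hint
  have hfour : ‖roundSpectrum (N + P).op - N.op‖ ≤ 4 * ‖P.op‖ :=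
    calc ‖roundSpectrum (N + P).op - N.op‖
        = ‖P.op - ((N + P).op - roundSpectrum (N + P).op)‖ := by
          rw [op_add]
          congr 1
          abel
      _ ≤ ‖P.op‖ + π / 2 * ‖P.op‖ := (_root_.norm_sub_le _ _).trans (by gcongr)
      _ ≤ 4 * ‖P.op‖ := by nlinarith [pi_le_four, _root_.norm_nonneg P.op]
  have hN₀ := norm_nonneg κ N
  generalize N.norm κ = n at *
  calc ‖roundSpectrum (N + P).op - N.op‖
      ≤ 4 * (Fintype.card (Site d L) * (exp (-κ) * p)) * 1 := by linarith
    _ ≤ 4 * (Fintype.card (Site d L) * (exp (-κ) * p)) * (2 * π * (exp (-κ) * n)) := by gcongr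
    _ = Fintype.card (Site d L) * (8 * π * exp (-κ + -κ) * (p * n)) := by rw [exp_add]; ring
    _ ≤ Fintype.card (Site d L) * (8 * π * exp (-(5 * κ / 4)) * (p * n)) := by
        gcongr
        linarith

include hon hN hP hint hκ hp

/-- If all terms of `N` are small, then `N` is a multiple of the identity and itself conserved.
Otherwise the spectrum of the Hamiltonian is rounded. -/
theorem nonempty (hη : 0 ≤ η) : Nonempty (Splitting N (N + P) κ p η) := by
  have hp₀ : 0 ≤ p := (norm_nonneg _ _).trans hp
  by_cases hsmall : ∀ x, 2 * π * ‖N.term {x}‖ < 1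
  · have hcomm := hon.commute_op_of_forall_two_pi_mul_norm_lt_one hN
      (heisenberg_two_pi hN.op hint) hsmall
    refine ⟨ofCommute (hN.add hP) hN.op hint (hcomm _).symm hp₀ hη ?_⟩
    have hN₀ := norm_nonneg κ N
    rw [sub_self, _root_.norm_zero]
    exact mul_nonneg (Nat.cast_nonneg _) (mul_nonneg (by positivity) (mul_nonneg hp₀ hN₀))
  · push Not at hsmall
    obtain ⟨x, hx⟩ := hsmall
    have hH := (hN.add hP).op
    exact ⟨ofCommute (hN.add hP) (isSelfAdjoint_roundSpectrum _)
      (exists_int_of_mem_spectrum_roundSpectrum hH (Matrix.finite_spectrum _))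
      (commute_roundSpectrum hH) hp₀ hη (norm_roundSpectrum_sub_le hN hP hint hκ hp
        (hx.trans (by gcongr; exact norm_term_singleton_le hκ.le N x)))⟩

/-- The width `κ / 4` available to the iteration is divided among the first `⌊x⌋` steps. -/
theorem exists_local (hx : 0 < x) (hsmall : 400 * π * (x * p) ≤ κ) :
    ∃ F : Splitting N (N + P) κ p (exp (1 - x)),
      F.number.norm (κ / 2) ≤ 2 * N.norm κ ∧ F.dressed.norm (κ / 2) ≤ 4 * p := by
  have hp₀ : 0 ≤ p := (norm_nonneg _ _).trans hp
  have hwidth : (⌊x⌋₊ : ℝ) * (κ / (4 * x)) ≤ κ / 4 :=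
    calc (⌊x⌋₊ : ℝ) * (κ / (4 * x)) ≤ x * (κ / (4 * x)) := by
          gcongr
          exact Nat.floor_le hx.le
      _ = κ / 4 := by field_simp
  have hstep : 4 * π * p / (κ / (4 * x)) ≤ 1 / 25 := by
    rw [div_le_iff₀ (by positivity), ← sub_nonneg]
    have : 1 / 25 * (κ / (4 * x)) - 4 * π * p = (κ - 400 * π * (x * p)) / (100 * x) := by
      field_simp
      ring
    rw [this]
    exact div_nonneg (sub_nonneg.2 hsmall) (by positivity)
  obtain ⟨F⟩ := NormalForm.nonempty hon hN hP (heisenberg_two_pi hN.op hint) hκ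
    (div_pos hκ (mul_pos four_pos hx)) hp hstep ⌊x⌋₊ hwidth
  rw [← op_add] at F
  refine ⟨F.toSplitting hκ hp₀ hwidth hN hint (eighth_pow_floor_le_exp x), ?_, ?_⟩
  · exact (F.norm_back_le_of_le hκ hwidth N).trans
      (mul_le_mul_of_nonneg_left (norm_mono (by linarith) N) zero_le_two)
  · have hZ := F.norm_back_le_of_le hκ hwidth F.Z
    exact hZ.trans (by linarith [F.norm_Z_le_of_le hp₀ hwidth])

theorem exists_of_pos (hx : 0 < x) : ∃ F : Splitting N (N + P) κ p (exp (1 - x)),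
    400 * π * (x * p) ≤ κ →
      F.number.norm (κ / 2) ≤ 2 * N.norm κ ∧ F.dressed.norm (κ / 2) ≤ 4 * p := by
  by_cases hsmall : 400 * π * (x * p) ≤ κ
  · obtain ⟨F, hF⟩ := exists_local hon hN hP hint hκ hp hx hsmall
    exact ⟨F, fun _ => hF⟩
  · obtain ⟨F⟩ := nonempty hon hN hP hint hκ hp (exp_pos (1 - x)).le
    exact ⟨F, fun h => absurd h hsmall⟩

end Existence

section Consequences

variable (F : Splitting N H κ p (exp (1 - x))) (hκ : 0 < κ) (hp : 0 ≤ p)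

include hκ hp

theorem norm_number_sub_div_card_le : ‖F.number.op - N.op‖ / Fintype.card (Site d L) ≤
    256 * π * (exp 1 / (exp 1 - 1)) * (exp (-κ / 4) / κ) * (p * N.norm κ) := by
  have hcard : (0 : ℝ) < Fintype.card (Site d L) := by exact_mod_cast Fintype.card_pos
  have hexp : exp (-(5 * κ / 4)) ≤ exp (-κ / 4) / κ :=
    calc exp (-(5 * κ / 4)) = exp (-κ / 4) * exp (-κ) := by rw [← exp_add]; ring_nf
      _ ≤ exp (-κ / 4) * (exp (-1) / κ) := by
          gcongr
          exact exp_neg_le_exp_neg_one_div hκ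
      _ ≤ exp (-κ / 4) * (1 / κ) := by
          gcongr
          exact exp_le_one_iff.2 (by norm_num)
      _ = exp (-κ / 4) / κ := mul_one_div _ _
  have hN := norm_nonneg κ N
  rw [div_le_iff₀' hcard]
  refine F.norm_number_sub_le.trans (mul_le_mul_of_nonneg_left ?_ hcard.le)
  generalize N.norm κ = n at *
  calc 8 * π * exp (-(5 * κ / 4)) * (p * n)
      ≤ 256 * π * 1 * (exp (-κ / 4) / κ) * (p * n) := by
        rw [mul_one]
        gcongr
        norm_num
    _ ≤ _ := by
        gcongr
        exact one_le_exp_one_div_sub_one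

theorem norm_heisenberg_number_sub_div_card_le (hH : H.SelfAdj) (t : ℝ) :
    ‖heisenberg H.op t F.number.op - F.number.op‖ / Fintype.card (Site d L) ≤
      16 / (3 * κ) * p * N.norm (3 * κ / 4) * |t| * exp (-x) := by
  have hcard : (0 : ℝ) < Fintype.card (Site d L) := by exact_mod_cast Fintype.card_pos
  have hN := norm_nonneg (3 * κ / 4) N
  have hlie := mul_le_mul_of_nonneg_left F.norm_lie_number_le (abs_nonneg t)
  rw [div_le_iff₀' hcard]
  refine (norm_heisenberg_sub_le hH.op t _).trans (hlie.trans ?_)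
  generalize N.norm (3 * κ / 4) = n at *
  calc |t| * (Fintype.card (Site d L) * (2 * exp (-(3 * κ / 4)) * (p * exp (1 - x)) * n))
      = Fintype.card (Site d L) * |t| * p * n * 2 * (exp (-(3 * κ / 4)) * exp (1 - x)) := by ring
    _ ≤ Fintype.card (Site d L) * |t| * p * n * 4 * (4 / (3 * κ) * exp (-x)) := by
        gcongr ?_ * ?_ * ?_
        · norm_num
        · exact exp_neg_mul_exp_one_sub_le hκ x
    _ = _ := by ring

omit hp in
theorem norm_heisenberg_dressed_sub_div_card_le (hH : H.SelfAdj) (t : ℝ) :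
    ‖heisenberg H.op t F.dressed.op - F.dressed.op‖ / Fintype.card (Site d L) ≤
      16 / (3 * κ) * (exp 1 / (exp 1 - 1)) * p ^ 2 * |t| * exp (-x) := by
  have hcard : (0 : ℝ) < Fintype.card (Site d L) := by exact_mod_cast Fintype.card_pos
  have hlie := mul_le_mul_of_nonneg_left F.norm_lie_dressed_le (abs_nonneg t)
  rw [div_le_iff₀' hcard]
  refine (norm_heisenberg_sub_le hH.op t _).trans (hlie.trans ?_)
  calc |t| * (Fintype.card (Site d L) * (4 * exp (-(3 * κ / 4)) * (p * exp (1 - x)) * p))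
      = Fintype.card (Site d L) * |t| * p ^ 2 * 4 * 1 *
          (exp (-(3 * κ / 4)) * exp (1 - x)) := by ring
    _ ≤ Fintype.card (Site d L) * |t| * p ^ 2 * 4 * (exp 1 / (exp 1 - 1)) *
          (4 / (3 * κ) * exp (-x)) := by
        have hone := one_le_exp_one_div_sub_one
        have hexp := exp_neg_mul_exp_one_sub_le hκ x
        gcongr ?_ * ?_
        gcongr
    _ = _ := by ring

end Consequences

theorem exists_norm_heisenberg_sub_heisenberg_le (d : ℕ) (hκ : 0 < κ) :
    ∃ K : ℝ, 0 ≤ K ∧ ∀ (L q : ℕ) (N H : ExtOp d L q) (p x : ℝ)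
      (F : Splitting N H κ p (exp (1 - x))), H.SelfAdj → 0 ≤ p → 0 ≤ x → ∀ b : ℝ, 1 ≤ b →
      H.norm κ ≤ b → ∀ (S : Finset (Site d L)) (O : Op d L q) (t : ℝ), IsConn S →
      SupportedOn S O → |t| ≤ exp (x / (d + 1)) →
      ‖heisenberg H.op t O - heisenberg (F.number + F.dressed).op t O‖ ≤
        2 ^ (d + 1) * (K * S.card) * b ^ d * exp 1 * p * ‖O‖ := by
  obtain ⟨K, hK, hdyn⟩ := Prethermal.exists_norm_heisenberg_sub_heisenberg_le d hκ
  refine ⟨K, hK, fun L q N H p x F hH hp hx b hb hHb S O t hS hO ht => ?_⟩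
  have hop : (F.number + F.dressed).op = H.op - F.remainder.op := by
    rw [← F.op_eq, op_add _ F.remainder, add_sub_cancel_right]
  rw [hop]
  calc ‖heisenberg H.op t O - heisenberg (H.op - F.remainder.op) t O‖
      ≤ K * S.card * b ^ d * F.remainder.norm (κ / 2) * ‖O‖ * (|t| * (1 + |t|) ^ d) :=
        hdyn L q H F.remainder hH F.selfAdj_remainder b hb hHb S O hS.nonempty hO t
    _ ≤ K * S.card * b ^ d * (2 * (p * exp (1 - x))) * ‖O‖ * (2 ^ d * exp x) := by
        have hR := F.norm_remainder_le
        have hg : 0 ≤ |t| * (1 + |t|) ^ d := by positivity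
        have hgrowth := mul_one_add_pow_le hx ht
        generalize |t| * (1 + |t|) ^ d = g at *
        gcongr
    _ = 2 ^ (d + 1) * (K * S.card) * b ^ d * (exp (1 - x) * exp x) * p * ‖O‖ := by ring
    _ = 2 ^ (d + 1) * (K * S.card) * b ^ d * exp 1 * p * ‖O‖ := by
        rw [← exp_add, sub_add_cancel]

end Splitting

variable {ε : ℝ}

theorem evol_eq_heisenberg (H A : Op d L q) (t : ℝ) : evol H t A = heisenberg H t A := rfl

theorem one_le_bracket (x : ℝ) : 1 ≤ bracket x :=
  one_le_sqrt.2 (le_add_of_nonneg_right (sq_nonneg x))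

theorem le_bracket (x : ℝ) : x ≤ bracket x :=
  le_sqrt_of_sq_le (le_add_of_nonneg_left zero_le_one)

theorem norm_ofReal_smul_le (hε : 0 ≤ ε) (P : ExtOp d L q) :
    ((ε : ℂ) • P).norm κ ≤ ε * P.norm κ := by
  simpa only [Complex.norm_of_nonneg hε] using ExtOp.norm_smul_le κ (ε : ℂ) P

theorem norm_add_smul_le_bracket (hε : 0 ≤ ε) : (N + (ε : ℂ) • P).norm κ ≤
    bracket (N.norm κ + ε * (exp 1 / (exp 1 - 1)) * P.norm κ) := by
  have hP := norm_nonneg κ P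
  have hsum := ExtOp.norm_add_le κ N ((ε : ℂ) • P)
  have hsmul := norm_ofReal_smul_le (κ := κ) hε P
  have hone := one_le_exp_one_div_sub_one
  generalize P.norm κ = p at *
  refine le_trans ?_ (le_bracket _)
  calc (N + (ε : ℂ) • P).norm κ ≤ N.norm κ + ε * 1 * p := by linarith
    _ ≤ N.norm κ + ε * (exp 1 / (exp 1 - 1)) * p := by gcongr

theorem dynamics_constant_le {K p s b n : ℝ} (hε : 0 ≤ ε) (hp : 0 ≤ p) (hs : 0 ≤ s) (hb : 0 ≤ b)
    (hn : 0 ≤ n) :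
    2 ^ (d + 1) * (K * s) * b ^ d * exp 1 * (ε * p) * n ≤
      (8 * π * (exp 1 / (exp 1 - 1)) * p * s +
        2 ^ (d + 1) * (K * s + 1) * b ^ d * exp 1 * p) * ε * n := by
  have hzero := zero_le_one.trans one_le_exp_one_div_sub_one
  calc 2 ^ (d + 1) * (K * s) * b ^ d * exp 1 * (ε * p) * n
      = (0 + 2 ^ (d + 1) * (K * s) * b ^ d * exp 1 * p) * ε * n := by ring
    _ ≤ _ := by
        gcongr
        · positivity
        · linarith

end Prethermal

end

open Lattice Real Prethermal in
theorem theorem1_general (d : ℕ) (κ : ℝ) (hκ : 0 < κ) :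
    ∃ C_LR : ℕ → ℝ, (∀ s, 0 < C_LR s) ∧
    ∀ (L q : ℕ) (N P : ExtOp d L q) (ε ε₀ : ℝ),
      N.SelfAdj → P.SelfAdj → N.OnSite → IntSpectrum N.op →
      0 < ε → 0 < ε₀ →
      ∃ 𝒩 𝒵 : ExtOp d L q,
        𝒩.SelfAdj ∧ 𝒵.SelfAdj ∧
        (ε₀ * (64 * π * (3 * (exp 1 - 1) + exp 1 ^ 2) * P.norm κ) ≤ (exp 1 - 1) * κ →
          𝒩.norm (κ / 2) ≤ 4 * N.norm κ ∧
          𝒵.norm (κ / 2) ≤ 4 * (exp 1 / (exp 1 - 1)) * ε * P.norm κ) ∧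
        IntSpectrum 𝒩.op ∧
        ‖𝒩.op - N.op‖ / Fintype.card (Site d L) ≤
          (256 * π * (exp 1 / (exp 1 - 1)) * (exp (-κ / 4) / κ) * P.norm κ) * ε * N.norm κ ∧
        (∀ t : ℝ,
          ‖evol (N.op + (ε : ℂ) • P.op) t 𝒩.op - 𝒩.op‖ / Fintype.card (Site d L) ≤
            (16 / (3 * κ) * P.norm κ) * N.norm (3 * κ / 4) * |t| * ε * exp (-ε₀ / ε)) ∧
        (∀ t : ℝ,
          ‖evol (N.op + (ε : ℂ) • P.op) t 𝒵.op - 𝒵.op‖ / Fintype.card (Site d L) ≤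
            (16 / (3 * κ) * (exp 1 / (exp 1 - 1)) * P.norm κ ^ 2) * |t| * ε ^ 2 *
              exp (-ε₀ / ε)) ∧
        𝒩.op * 𝒵.op - 𝒵.op * 𝒩.op = 0 ∧
        (∀ (S : Finset (Site d L)) (O : Op d L q) (t : ℝ),
          IsConn S → SupportedOn S O → |t| ≤ exp (ε₀ / ((d + 1) * ε)) →
          ‖evol (N.op + (ε : ℂ) • P.op) t O - evol (𝒩.op + 𝒵.op) t O‖ ≤
            (8 * π * (exp 1 / (exp 1 - 1)) * P.norm κ * S.card +
              2 ^ (d + 1) * C_LR S.card *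
                bracket (N.norm κ + ε * (exp 1 / (exp 1 - 1)) * P.norm κ) ^ d *
                exp 1 * P.norm κ) * ε * ‖O‖) := by
  obtain ⟨K, hK, hdyn⟩ := Splitting.exists_norm_heisenberg_sub_heisenberg_le d hκ
  refine ⟨fun s => K * s + 1, fun s => by positivity,
    fun L q N P ε ε₀ hN hP hon hint hε hε₀ => ?_⟩
  have hP₀ := ExtOp.norm_nonneg κ P
  have hp := mul_nonneg hε.le hP₀
  have hx := div_pos hε₀ hε
  have hεP : ((ε : ℂ) • P).SelfAdj := hP.smul (Complex.conj_ofReal ε)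
  have hH := hN.add hεP
  obtain ⟨F, hF⟩ := Splitting.exists_of_pos hon hN hεP hint hκ (norm_ofReal_smul_le hε.le P) hx
  simp only [← ExtOp.op_smul, ← ExtOp.op_add, evol_eq_heisenberg, neg_div ε ε₀]
  refine ⟨F.number, F.dressed, F.selfAdj_number, F.selfAdj_dressed, fun hε₀P => ?_,
    F.intSpectrum_number, (F.norm_number_sub_div_card_le hκ hp).trans_eq (by ring), fun t =>
    (F.norm_heisenberg_number_sub_div_card_le hκ hp hH t).trans_eq (by ring), fun t =>
    (F.norm_heisenberg_dressed_sub_div_card_le hκ hH t).trans_eq (by ring),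
    sub_eq_zero.2 F.commute.eq, fun S O t hS hO ht => ?_⟩
  · have hxp : ε₀ / ε * (ε * P.norm κ) = ε₀ * P.norm κ := by field_simp
    obtain ⟨hnumber, hdressed⟩ := hF (mul_le_of_step_condition (mul_nonneg hx.le hp)
      (by rw [hxp]; linarith))
    refine ⟨by linarith [N.norm_nonneg κ], hdressed.trans ?_⟩
    linarith [mul_le_mul_of_nonneg_right one_le_exp_one_div_sub_one hp]
  · exact (hdyn L q N _ _ _ F hH hp hx.le _ (one_le_bracket _) (norm_add_smul_le_bracket hε.le)
      S O t hS hO (by rwa [div_div, mul_comm ε])).trans (dynamics_constant_le hε.le hP₀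
        (Nat.cast_nonneg _) (zero_le_one.trans (one_le_bracket _)) (norm_nonneg O))

open Lattice Real in
theorem theorem1 (d : ℕ) (κ : ℝ) (hκ : 0 < κ) :
    ∃ C_LR : ℕ → ℝ, (∀ s, 0 < C_LR s) ∧
    ∀ (L q : ℕ) (N P : ExtOp d L q) (ε ε₀ : ℝ),
      N.SelfAdj → P.SelfAdj → N.OnSite → IntSpectrum N.op →
      0 < ε → ε < ε₀ →
      ε₀ * (64 * π * (3 * (exp 1 - 1) + exp 1 ^ 2) * P.norm κ) ≤ exp 1 - 1 →
      ∃ 𝒩 𝒵 : ExtOp d L q,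
        𝒩.SelfAdj ∧ 𝒵.SelfAdj ∧
        -- locality of the two operators, uniformly in the size of the lattice
        (ε₀ * (64 * π * (3 * (exp 1 - 1) + exp 1 ^ 2) * P.norm κ) ≤ (exp 1 - 1) * κ →
          𝒩.norm (κ / 2) ≤ 4 * N.norm κ ∧
          𝒵.norm (κ / 2) ≤ 4 * (exp 1 / (exp 1 - 1)) * ε * P.norm κ) ∧
        -- (i)
        IntSpectrum 𝒩.op ∧
        -- (ii)
        ‖𝒩.op - N.op‖ / Fintype.card (Site d L) ≤
          (256 * π * (exp 1 / (exp 1 - 1)) * (exp (-κ / 4) / κ) * P.norm κ) * ε * N.norm κ ∧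
        -- (iii)
        (∀ t : ℝ,
          ‖evol (N.op + (ε : ℂ) • P.op) t 𝒩.op - 𝒩.op‖ / Fintype.card (Site d L) ≤
            (16 / (3 * κ) * P.norm κ) * N.norm (3 * κ / 4) * |t| * ε * exp (-ε₀ / ε)) ∧
        (∀ t : ℝ,
          ‖evol (N.op + (ε : ℂ) • P.op) t 𝒵.op - 𝒵.op‖ / Fintype.card (Site d L) ≤
            (16 / (3 * κ) * (exp 1 / (exp 1 - 1)) * P.norm κ ^ 2) * |t| * ε ^ 2 *
              exp (-ε₀ / ε)) ∧
        -- (iv)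
        𝒩.op * 𝒵.op - 𝒵.op * 𝒩.op = 0 ∧
        -- (v)
        (∀ (S : Finset (Site d L)) (O : Op d L q) (t : ℝ),
          IsConn S → SupportedOn S O → |t| ≤ exp (ε₀ / ((d + 1) * ε)) →
          ‖evol (N.op + (ε : ℂ) • P.op) t O - evol (𝒩.op + 𝒵.op) t O‖ ≤
            (8 * π * (exp 1 / (exp 1 - 1)) * P.norm κ * S.card +
              2 ^ (d + 1) * C_LR S.card *
                bracket (N.norm κ + ε * (exp 1 / (exp 1 - 1)) * P.norm κ) ^ d *
                exp 1 * P.norm κ) * ε * ‖O‖) := by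
  obtain ⟨C_LR, hpos, h⟩ := theorem1_general d κ hκ
  exact ⟨C_LR, hpos, fun L q N P ε ε₀ hN hP hon hint hε hε₀ _ =>
    h L q N P ε ε₀ hN hP hon hint hε (hε.trans hε₀)⟩
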